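/- Let $H\subset \mathrm{SL}(3,\mathbb R)$ be the Heisenberg group of unipotent upper-triangular matrices, and let $G=\theta(H)\subset \mathrm{SL}(10,\mathbb R)$, where $\theta:H\to\mathrm{SL}(10,\mathbb R)$ is the homomorphism $$ \theta\begin{pmatrix}1&a&c\\0&1&b\\0&0&1\end{pmatrix}= \begin{pmatrix} 1&2a&2c&a&a^2/2&a^3/6&b&2a^2+b^2/2&b^3/6+2ac&(a^4+b^4)/24+c^2\\ 0&1&b&0&0&0&0&2a&ab+c&bc\\ 0&0&1&0&0&0&0&0&a&c\\ 0&0&0&1&a&a^2/2&0&0&0&a^3/6\\ 0&0&0&0&1&a&0&0&0&a^2/2\\ 0&0&0&0&0&1&0&0&0&a\\ 0&0&0&0&0&0&1&b&b^2/2&b^3/6\\ 0&0&0&0&0&0&0&1&b&b^2/2\\ 0&0&0&0&0&0&0&0&1&b\\ 0&0&0&0&0&0&0&0&0&1 \end{pmatrix}. $$ A strictly convex domain in $\mathbb{RP}^n$ is a non-empty open set whose closure lies in an affine patch, which is convex in that patch, and whose boundary contains no non-degenerate projective line segment. A lattice in $G$ is a discrete subgroup $\Gamma$ such that $G/\Gamma$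 carries a non-zero finite $G$-invariant Borel measure. There are a strictly convex domain $\Omega\subset\mathbb{RP}^9$ preserved by $G$ and a lattice $\Gamma$ in $G$ such that $\Gamma$ acts freely and properly discontinuously on $\Omega$; the quotient $\Omega/\Gamma$ is a (Hausdorff, second countable) $9$-dimensional real projective manifold, with the projective structure for which $\Omega\to\Omega/\Gamma$ is a local isomorphism; the fundamental group of $\Omega/\Gamma$ is isomorphic to $\Gamma$; and $$\Gamma\cong\langle \alpha,\beta : [\alpha,[\alpha,\beta]],\ [\beta,[\alpha,\beta]]\rangle$$ is nilpotent and not virtually abelian. Moreover $\Gamma$ is unipotent, i.e. $\gamma-1$ is a nilpotent matrix for every $\gamma\in\Gamma$. -/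

import Mathlib

open scoped LinearAlgebra.Projectivization Topology MatrixGroups MeasureTheory commutatorElement

noncomputable section

/-! ### Real projective space -/

/-- Real projective space `ℝℙⁿ`, with homogeneous coordinates indexed by `Fin (n + 1)`. -/
abbrev RP (n : ℕ) : Type := ℙ ℝ (Fin (n + 1) → ℝ)

/-- The quotient topology of `ℝⁿ⁺¹ ∖ {0}`. -/
instance RP.instTopologicalSpace (n : ℕ) : TopologicalSpace (RP n) :=
  TopologicalSpace.coinduced
    (fun v : {v : Fin (n + 1) → ℝ // v ≠ 0} => Projectivization.mk ℝ v.1 v.2) inferInstance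

/-- The affine patch `x ↦ [x₁ : ⋯ : xₙ : 1]`. -/
def affinePoint {n : ℕ} (x : EuclideanSpace ℝ (Fin n)) : RP n :=
  Projectivization.mk ℝ (Fin.snoc (α := fun _ => ℝ) (fun i => x i) 1) (fun h => by
    have := congrFun h (Fin.last n)
    simp at this)

/-! ### Convexity in projective space -/

/-- The projective line segment joining `[u]` and `[v]` that is the image of the segment joining
the vectors `u` and `v`. -/
def projSegment {n : ℕ} (u v : Fin (n + 1) → ℝ) : Set (RP n) :=
  {p | ∃ s t : ℝ, 0 ≤ s ∧ 0 ≤ t ∧ ∃ h : s • u + t • v ≠ 0,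
    p = Projectivization.mk ℝ (s • u + t • v) h}

/-- A subset of projective space is properly convex if its closure is contained in an affine patch
`{φ ≠ 0}` and it is convex in the affine coordinates `{φ = 1}` of that patch. -/
def IsProperlyConvex {n : ℕ} (Ω : Set (RP n)) : Prop :=
  ∃ φ : Module.Dual ℝ (Fin (n + 1) → ℝ),
    (∀ p ∈ closure Ω, φ p.rep ≠ 0) ∧
    Convex ℝ {v : Fin (n + 1) → ℝ | φ v = 1 ∧ ∃ h : v ≠ 0, Projectivization.mk ℝ v h ∈ Ω}

/-- A strictly convex domain: a non-empty open properly convex set whose boundary contains no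
non-degenerate projective line segment. -/
structure IsStrictlyConvexDomain {n : ℕ} (Ω : Set (RP n)) : Prop where
  nonempty : Ω.Nonempty
  isOpen : IsOpen Ω
  properlyConvex : IsProperlyConvex Ω
  no_segment : ∀ u v : Fin (n + 1) → ℝ, LinearIndependent ℝ ![u, v] →
    ¬ projSegment u v ⊆ frontier Ω

/-! ### Real projective manifolds -/

/-- The pseudogroup on `ℝⁿ` of homeomorphisms between open sets that are locally restrictions of
projective transformations of `ℝℙⁿ`. -/
def projectiveGroupoid (n : ℕ) : StructureGroupoid (EuclideanSpace ℝ (Fin n)) where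
  members := {e | ∀ x ∈ e.source, ∃ A : (Fin (n + 1) → ℝ) ≃ₗ[ℝ] (Fin (n + 1) → ℝ),
    ∀ᶠ y in 𝓝 x, affinePoint (e y) = A • affinePoint y}
  trans' := by
    intro e e' he he' x hx
    rw [OpenPartialHomeomorph.trans_source] at hx
    obtain ⟨A, hA⟩ := he x hx.1
    obtain ⟨B, hB⟩ := he' (e x) hx.2
    refine ⟨B * A, ?_⟩
    filter_upwards [hA, (e.continuousAt hx.1).eventually hB] with y hy hy'
    rw [OpenPartialHomeomorph.coe_trans, Function.comp_apply, hy', hy, mul_smul]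
  symm' := by
    intro e he x hx
    obtain ⟨A, hA⟩ := he (e.symm x) (e.map_target hx)
    refine ⟨A⁻¹, ?_⟩
    filter_upwards [(e.symm.continuousAt hx).eventually hA, e.open_target.mem_nhds hx]
      with y hy hyt
    rw [e.right_inv hyt] at hy
    rw [hy, inv_smul_smul]
  id_mem' := by
    intro x _
    exact ⟨1, Filter.Eventually.of_forall fun y => by simp⟩
  locality' := by
    intro e he x hx
    obtain ⟨s, hs, hxs, h⟩ := he x hx
    refine h x ?_
    rw [OpenPartialHomeomorph.restr_source, hs.interior_eq]
    exact ⟨hx, hxs⟩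
  mem_of_eqOnSource' := by
    intro e e' he hee' x hx
    have hx' : x ∈ e.source := hee'.1 ▸ hx
    obtain ⟨A, hA⟩ := he x hx'
    refine ⟨A, ?_⟩
    filter_upwards [hA, e'.open_source.mem_nhds hx] with y hy hys
    rw [hee'.2 hys, hy]

/-- `M` is an `n`-dimensional real projective manifold, with the projective structure for which
`π : U → M` is a local isomorphism; here `U` is a subset of `ℝℙⁿ`. -/
def IsProjectiveManifoldVia {n : ℕ} {U : Set (RP n)} {M : Type} [TopologicalSpace M]
    (π : U → M) : Prop :=
  T2Space M ∧ SecondCountableTopology M ∧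
  ∃ _ : ChartedSpace (EuclideanSpace ℝ (Fin n)) M,
    HasGroupoid M (projectiveGroupoid n) ∧
    ∀ e ∈ atlas (EuclideanSpace ℝ (Fin n)) M, ∀ p : U, π p ∈ e.source →
      ∃ A : (Fin (n + 1) → ℝ) ≃ₗ[ℝ] (Fin (n + 1) → ℝ),
        ∀ᶠ q in 𝓝 p, affinePoint (e (π q)) = A • (q : RP n)

/-! ### Groups -/

/-- A lattice: a discrete subgroup `Γ` such that `G ⧸ Γ` carries a non-zero finite `G`-invariant
Borel measure. -/
def IsLatticeIn {G : Type*} [Group G] [TopologicalSpace G] (Γ : Subgroup G) : Prop :=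
  DiscreteTopology Γ ∧
  ∃ μ : @MeasureTheory.Measure (G ⧸ Γ) (borel (G ⧸ Γ)), μ ≠ 0 ∧ μ Set.univ < ⊤ ∧
    ∀ (g : G) (s : Set (G ⧸ Γ)), MeasurableSet[borel (G ⧸ Γ)] s →
      μ ((fun x => g • x) ⁻¹' s) = μ s

/-- A group is virtually abelian if it has an abelian subgroup of finite index. -/
def IsVirtuallyAbelian (G : Type*) [Group G] : Prop :=
  ∃ N : Subgroup G, N.FiniteIndex ∧ ∀ x ∈ N, ∀ y ∈ N, x * y = y * x

/-- The relators `[α, [α, β]]` and `[β, [α, β]]` in the free group on `α` and `β`. -/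
def heisenbergRels : Set (FreeGroup (Fin 2)) :=
  let α := FreeGroup.of (0 : Fin 2)
  let β := FreeGroup.of (1 : Fin 2)
  {⁅α, ⁅α, β⁆⁆, ⁅β, ⁅α, β⁆⁆}

/-- The Heisenberg group of unipotent upper-triangular matrices in `SL(3, ℝ)`. -/
def heisenbergGroup : Subgroup SL(3, ℝ) where
  carrier := {M | (∀ i, M i i = 1) ∧ ∀ i j, j < i → M i j = 0}
  one_mem' := by
    refine ⟨fun i => by simp, fun i j h => ?_⟩
    simp [Matrix.one_apply_ne h.ne']
  mul_mem' := by
    rintro M N ⟨h1, h0⟩ ⟨k1, k0⟩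
    have h10 := h0 1 0 (by decide)
    have h20 := h0 2 0 (by decide)
    have h21 := h0 2 1 (by decide)
    have k10 := k0 1 0 (by decide)
    have k20 := k0 2 0 (by decide)
    have k21 := k0 2 1 (by decide)
    refine ⟨fun i => ?_, fun i j h => ?_⟩
    · fin_cases i <;> simp [Matrix.mul_apply, Fin.sum_univ_three, *]
    · fin_cases i <;> fin_cases j <;>
        simp [Matrix.mul_apply, Fin.sum_univ_three, *] at h ⊢
  inv_mem' := by
    rintro M ⟨h1, h0⟩
    have h10 := h0 1 0 (by decide)
    have h20 := h0 2 0 (by decide)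
    have h21 := h0 2 1 (by decide)
    refine ⟨fun i => ?_, fun i j h => ?_⟩
    · fin_cases i <;>
        simp [Matrix.SpecialLinearGroup.coe_inv, Matrix.adjugate_fin_three, *]
    · fin_cases i <;> fin_cases j <;>
        simp [Matrix.SpecialLinearGroup.coe_inv, Matrix.adjugate_fin_three, *] at h ⊢

/-- The matrix `θ(a, b, c)`. -/
def thetaMatrix (a b c : ℝ) : Matrix (Fin 10) (Fin 10) ℝ :=
  !![1, 2*a, 2*c, a, a^2/2, a^3/6, b, 2*a^2 + b^2/2, b^3/6 + 2*a*c, (a^4 + b^4)/24 + c^2;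
     0, 1, b, 0, 0, 0, 0, 2*a, a*b + c, b*c;
     0, 0, 1, 0, 0, 0, 0, 0, a, c;
     0, 0, 0, 1, a, a^2/2, 0, 0, 0, a^3/6;
     0, 0, 0, 0, 1, a, 0, 0, 0, a^2/2;
     0, 0, 0, 0, 0, 1, 0, 0, 0, a;
     0, 0, 0, 0, 0, 0, 1, b, b^2/2, b^3/6;
     0, 0, 0, 0, 0, 0, 0, 1, b, b^2/2;
     0, 0, 0, 0, 0, 0, 0, 0, 1, b;
     0, 0, 0, 0, 0, 0, 0, 0, 0, 1]

theorem thetaMatrix_det (a b c : ℝ) : (thetaMatrix a b c).det = 1 := by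
  rw [Matrix.det_of_isUpperTriangular]
  · simp [Fin.prod_univ_succ, thetaMatrix]
  · intro i j h
    fin_cases i <;> fin_cases j <;> first | rfl | (exact absurd h (by decide))

set_option maxHeartbeats 4000000 in
theorem thetaMatrix_mul (a b c a' b' c' : ℝ) :
    thetaMatrix (a + a') (b + b') (c + c' + a * b') = thetaMatrix a b c * thetaMatrix a' b' c' := by
  ext i j
  fin_cases i <;> fin_cases j <;>
    simp [thetaMatrix, Matrix.mul_apply, Fin.sum_univ_succ] <;> ring

/-- The representation `θ` of the Heisenberg group, sending the matrix with rows `(1, a, c)`,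
`(0, 1, b)`, `(0, 0, 1)` to `thetaMatrix a b c`. -/
def theta : heisenbergGroup →* SL(10, ℝ) where
  toFun M := ⟨thetaMatrix (M.1 0 1) (M.1 1 2) (M.1 0 2), thetaMatrix_det _ _ _⟩
  map_one' := by
    ext i j
    fin_cases i <;> fin_cases j <;> simp [thetaMatrix]
  map_mul' M N := by
    apply Subtype.ext
    have h : thetaMatrix ((M * N).1 0 1) ((M * N).1 1 2) ((M * N).1 0 2) =
        thetaMatrix (M.1 0 1 + N.1 0 1) (M.1 1 2 + N.1 1 2)
          (M.1 0 2 + N.1 0 2 + M.1 0 1 * N.1 1 2) := by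
      have m := M.2.1
      have n := N.2.1
      have m10 := M.2.2 1 0 (by decide)
      have n21 := N.2.2 2 1 (by decide)
      congr 1 <;> simp [Matrix.mul_apply, Fin.sum_univ_three, m, n, m10, n21] <;> ring
    exact h.trans (thetaMatrix_mul _ _ _ _ _ _)

/-- The group `G = θ(H)`. -/
abbrev thetaGroup : Subgroup SL(10, ℝ) := theta.range

end

noncomputable section

/-! ### The affine chart of projective space -/

namespace RP

variable {n : ℕ}

/-! The group `G` fixes the first basis vector and preserves the last coordinate, so it acts on the
affine patch where that coordinate is 1. Let `penalty` be the sum of the powers of order 5/4 of the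
absolute values of the eight middle coordinates. Its strict epigraph is convex, but not
`G`-invariant. The domain is the intersection of all `G`-translates of this epigraph, which is
invariant and convex for free; the question is whether it is open and non-empty.

Both follow from a weight count. Give `a` and `b` weight 1 and `c` weight 2. The top right entry of
θ has weight 4 and is bounded below by a positive multiple of m⁴, where m is the maximum of |a|, |b|
and √|c|; every other entry is O(m³). Along an orbit the first coordinate therefore grows like m⁴
and the penalty at most like m^(15/4). Hence, uniformly for bounded vectors, only a compact set of
group elements imposes a condition (`exists_bound_penalty_lt`). The exponent 5/4 works because it
exceeds 1, for strict convexity and superlinear growth, and is less than 4/3.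

Strict convexity of the epigraph passes to the intersection: a point between two distinct points of
the closed version satisfies all the strict inequalities (`combo_mem_strictCap`). Superlinear growth
leaves at most the point [1 : 0 : ⋯ : 0] of the closure at infinity (`mk_mem_closure`), so no
boundary segment is hidden there.

For Γ take the elements with integral coordinates. Three homogeneous coordinates give a
Γ-equivariant map from the domain to the Heisenberg group with left multiplication, so the action is
free and properly discontinuous. The domain is contractible, whence the fundamental group of the
quotient. Lebesgue measure in coordinates is a bi-invariant Haar measure and the unit cube is a
fundamental domain of measure 1. The presentation comes from a normal form. -/

theorem isQuotientMap_mk :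
    Topology.IsQuotientMap
      (fun v : {v : Fin (n + 1) → ℝ // v ≠ 0} => Projectivization.mk ℝ v.1 v.2) where
  surjective p := ⟨⟨p.rep, p.rep_nonzero⟩, p.mk_rep⟩
  eq_coinduced := rfl

/-- The saturation of an open set is the union of its multiples by non-zero scalars. Openness allows
closures in projective space to be studied on representing vectors. -/
theorem isOpenMap_mk :
    IsOpenMap (fun v : {v : Fin (n + 1) → ℝ // v ≠ 0} => Projectivization.mk ℝ v.1 v.2) := by
  intro U hU
  rw [← isQuotientMap_mk.isOpen_preimage]
  have : (fun v : {v : Fin (n + 1) → ℝ // v ≠ 0} => Projectivization.mk ℝ v.1 v.2) ⁻¹'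
      ((fun v : {v : Fin (n + 1) → ℝ // v ≠ 0} => Projectivization.mk ℝ v.1 v.2) '' U) =
      ⋃ c : ℝˣ, (fun v : {v : Fin (n + 1) → ℝ // v ≠ 0} =>
        (⟨c • v.1, (smul_ne_zero_iff_ne c).mpr v.2⟩ : {v : Fin (n + 1) → ℝ // v ≠ 0})) ⁻¹' U := by
    ext v
    simp only [Set.mem_preimage, Set.mem_image, Set.mem_iUnion]
    constructor
    · rintro ⟨w, hw, h⟩
      obtain ⟨c, hc⟩ := (Projectivization.mk_eq_mk_iff ℝ _ _ w.2 v.2).mp h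
      exact ⟨c, by simpa only [hc] using hw⟩
    · rintro ⟨c, hc⟩
      exact ⟨_, hc, (Projectivization.mk_eq_mk_iff ℝ _ _ _ v.2).mpr ⟨c, rfl⟩⟩
  rw [this]
  exact isOpen_iUnion fun c => hU.preimage
    ((continuous_const_smul c).comp continuous_subtype_val |>.subtype_mk _)

theorem continuous_mk {X : Type*} [TopologicalSpace X] {f : X → Fin (n + 1) → ℝ}
    (hf : Continuous f) (h0 : ∀ x, f x ≠ 0) :
    Continuous fun x => Projectivization.mk ℝ (f x) (h0 x) :=
  isQuotientMap_mk.continuous.comp (hf.subtype_mk h0)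

/-- The representative of a point whose last coordinate is `1` (junk at infinity). -/
def normalize (p : RP n) : Fin (n + 1) → ℝ := (p.rep (Fin.last n))⁻¹ • p.rep

theorem normalize_mk (v : Fin (n + 1) → ℝ) (hv : v ≠ 0) :
    normalize (Projectivization.mk ℝ v hv) = (v (Fin.last n))⁻¹ • v := by
  obtain ⟨a, ha⟩ := Projectivization.exists_smul_eq_mk_rep ℝ v hv
  unfold normalize
  rw [← ha]
  ext i
  have := a.ne_zero
  simp [Units.smul_def]
  field_simp

theorem mk_normalize {p : RP n} (h' : normalize p ≠ 0) :
    Projectivization.mk ℝ (normalize p) h' = p := by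
  conv_rhs => rw [← p.mk_rep]
  rw [Projectivization.mk_eq_mk_iff']
  exact ⟨_, rfl⟩

theorem normalize_mk_of_last {v : Fin (n + 1) → ℝ} (hv : v ≠ 0) (h : v (Fin.last n) = 1) :
    normalize (Projectivization.mk ℝ v hv) = v := by
  rw [normalize_mk, h, inv_one, one_smul]

/-- Since `0⁻¹ = 0`, a point at infinity normalizes to the zero vector; "normalized last coordinate
equal to 1" thus characterizes the affine patch. -/
theorem last_ne_zero_of_inv_smul {v : Fin (n + 1) → ℝ}
    (h : ((v (Fin.last n))⁻¹ • v) (Fin.last n) = 1) : v (Fin.last n) ≠ 0 := by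
  intro h0
  simp [h0] at h

theorem normalize_affinePoint (x : EuclideanSpace ℝ (Fin n)) :
    normalize (affinePoint x) = Fin.snoc (α := fun _ => ℝ) (fun i => x i) 1 :=
  normalize_mk_of_last _ (by simp)

theorem affinePoint_init {p : RP n} (h : normalize p (Fin.last n) = 1) :
    affinePoint (WithLp.toLp 2 fun i : Fin n => normalize p i.castSucc) = p := by
  have h0 : normalize p ≠ 0 := fun h0 => by simp [h0] at h
  conv_rhs => rw [← mk_normalize h0]
  unfold affinePoint
  congr 1
  ext i
  refine Fin.lastCases ?_ (fun i => ?_) i <;> simp [h]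

theorem affinePoint_injective : Function.Injective (affinePoint (n := n)) := by
  intro x y h
  have := congrArg normalize h
  rw [normalize_affinePoint, normalize_affinePoint] at this
  ext i
  simpa using congrFun this i.castSucc

theorem continuous_affinePoint : Continuous (affinePoint (n := n)) := by
  refine continuous_mk ?_ _
  refine continuous_pi fun i => ?_
  refine Fin.lastCases ?_ (fun i => ?_) i
  · simpa using continuous_const
  · simp only [Fin.snoc_castSucc]
    fun_prop

/-- A subset of projective space is open if it is cut out of an affine patch by an open set of
vectors. -/
theorem isOpen_setOf_normalize {U : Set (Fin (n + 1) → ℝ)}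
    (hU : ∀ v ∈ U, v (Fin.last n) = 1 → ∀ᶠ w in 𝓝 v, w (Fin.last n) = 1 → w ∈ U) :
    IsOpen {p : RP n | normalize p (Fin.last n) = 1 ∧ normalize p ∈ U} := by
  rw [← isQuotientMap_mk.isOpen_preimage, isOpen_iff_mem_nhds]
  rintro ⟨v, hv⟩ ⟨h1, h2⟩
  simp only [normalize_mk] at h1 h2
  have hl : v (Fin.last n) ≠ 0 := by
    intro h
    simp [h] at h1
  have hlast : Continuous fun w : {w : Fin (n + 1) → ℝ // w ≠ 0} => w.1 (Fin.last n) :=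
    (continuous_apply _).comp continuous_subtype_val
  have hc : ContinuousAt (fun w : {w : Fin (n + 1) → ℝ // w ≠ 0} =>
      (w.1 (Fin.last n))⁻¹ • w.1) ⟨v, hv⟩ := by
    exact (hlast.continuousAt.inv₀ hl).smul continuous_subtype_val.continuousAt
  have hne : ∀ᶠ w : {w : Fin (n + 1) → ℝ // w ≠ 0} in 𝓝 ⟨v, hv⟩, w.1 (Fin.last n) ≠ 0 :=
    hlast.continuousAt.eventually_ne hl
  filter_upwards [hc.eventually (hU _ h2 h1), hne] with w hw hw0
  simp only [Set.mem_preimage, Set.mem_ofPred_eq, normalize_mk]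
  have h3 : ((w.1 (Fin.last n))⁻¹ • w.1) (Fin.last n) = 1 := by simp [hw0]
  exact ⟨h3, hw h3⟩

theorem isOpenEmbedding_affinePoint : Topology.IsOpenEmbedding (affinePoint (n := n)) := by
  refine .of_continuous_injective_isOpenMap continuous_affinePoint affinePoint_injective ?_
  intro s hs
  have : affinePoint '' s = {p : RP n | normalize p (Fin.last n) = 1 ∧
      normalize p ∈ {v | WithLp.toLp 2 (fun i : Fin n => v i.castSucc) ∈ s}} := by
    ext p
    constructor
    · rintro ⟨x, hx, rfl⟩
      simp only [Set.mem_ofPred_eq, normalize_affinePoint]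
      simpa using hx
    · rintro ⟨h1, h2⟩
      exact ⟨_, h2, affinePoint_init h1⟩
  rw [this]
  refine isOpen_setOf_normalize fun v hv _ => ?_
  have : IsOpen {v : Fin (n + 1) → ℝ | WithLp.toLp 2 (fun i : Fin n => v i.castSucc) ∈ s} :=
    hs.preimage ((PiLp.continuous_toLp 2 _).comp (by fun_prop))
  filter_upwards [this.mem_nhds hv] with w hw _ using hw

theorem continuousOn_normalize :
    ContinuousOn (normalize (n := n)) {p | normalize p (Fin.last n) = 1} := by
  have hr : {p : RP n | normalize p (Fin.last n) = 1} ⊆ Set.range (affinePoint (n := n)) :=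
    fun p hp => ⟨_, affinePoint_init hp⟩
  intro p hp
  obtain ⟨x, rfl⟩ := hr hp
  refine ContinuousAt.continuousWithinAt ?_
  rw [← isOpenEmbedding_affinePoint.continuousAt_iff]
  have : normalize ∘ affinePoint = fun x : EuclideanSpace ℝ (Fin n) =>
      Fin.snoc (α := fun _ => ℝ) (fun i => x i) 1 := funext normalize_affinePoint
  rw [this]
  refine Continuous.continuousAt (continuous_pi fun i => ?_)
  refine Fin.lastCases ?_ (fun i => ?_) i
  · simpa using continuous_const
  · simp only [Fin.snoc_castSucc]
    fun_prop

theorem continuous_smul_of_linear {G : Type*} [Group G] [DistribMulAction G (Fin (n + 1) → ℝ)]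
    [SMulCommClass G ℝ (Fin (n + 1) → ℝ)] (g : G) : Continuous fun p : RP n => g • p := by
  rw [isQuotientMap_mk.continuous_iff]
  refine continuous_mk (f := fun v : {v : Fin (n + 1) → ℝ // v ≠ 0} => g • v.1) ?_ _
  exact (LinearMap.continuous_of_finiteDimensional
    (DistribSMul.toLinearMap ℝ (Fin (n + 1) → ℝ) g)).comp continuous_subtype_val

end RP

/-! ### Coordinates on the group -/

/-- The unipotent upper-triangular matrix with rows `(1, a, c)`, `(0, 1, b)`, `(0, 0, 1)`. -/
def heisenbergMk (a b c : ℝ) : heisenbergGroup :=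
  ⟨⟨!![1, a, c; 0, 1, b; 0, 0, 1], by simp [Matrix.det_fin_three]⟩, by
    refine ⟨fun i => ?_, fun i j h => ?_⟩
    · fin_cases i <;> simp
    · fin_cases i <;> fin_cases j <;> simp at h ⊢⟩

/-- The element `θ(a, b, c)` of the group `G`. -/
def thetaMk (a b c : ℝ) : thetaGroup := ⟨theta (heisenbergMk a b c), _, rfl⟩

namespace thetaMk

theorem coe_matrix (a b c : ℝ) :
    ((thetaMk a b c : SL(10, ℝ)) : Matrix (Fin 10) (Fin 10) ℝ) = thetaMatrix a b c := rfl

theorem mul (a b c a' b' c' : ℝ) :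
    thetaMk a b c * thetaMk a' b' c' = thetaMk (a + a') (b + b') (c + c' + a * b') := by
  apply Subtype.ext
  apply Subtype.ext
  have h := thetaMatrix_mul a b c a' b' c'
  rw [← coe_matrix, ← coe_matrix, ← coe_matrix] at h
  exact h.symm

theorem eq_iff {a b c a' b' c' : ℝ} :
    thetaMk a b c = thetaMk a' b' c' ↔ a = a' ∧ b = b' ∧ c = c' := by
  constructor
  · intro h
    have h' : thetaMatrix a b c = thetaMatrix a' b' c' := by rw [← coe_matrix, ← coe_matrix, h]
    refine ⟨?_, ?_, ?_⟩
    · simpa [thetaMatrix] using congrFun (congrFun h' 2) 8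
    · simpa [thetaMatrix] using congrFun (congrFun h' 1) 2
    · simpa [thetaMatrix] using congrFun (congrFun h' 2) 9
  · rintro ⟨rfl, rfl, rfl⟩
    rfl

theorem one : thetaMk 0 0 0 = 1 := by
  have h := mul 0 0 0 0 0 0
  simp only [add_zero, mul_zero] at h
  exact mul_eq_left.mp h

theorem eq_one_iff {a b c : ℝ} : thetaMk a b c = 1 ↔ a = 0 ∧ b = 0 ∧ c = 0 := by
  rw [← one, eq_iff]

theorem inv (a b c : ℝ) : (thetaMk a b c)⁻¹ = thetaMk (-a) (-b) (a * b - c) := by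
  rw [inv_eq_iff_mul_eq_one, mul, eq_one_iff]
  refine ⟨by ring, by ring, by ring⟩

theorem exists_eq (g : thetaGroup) : ∃ a b c, g = thetaMk a b c := by
  obtain ⟨-, M, rfl⟩ := g
  refine ⟨M.1 0 1, M.1 1 2, M.1 0 2, ?_⟩
  unfold thetaMk
  congr 2
  apply Subtype.ext
  ext i j
  have h1 := M.2.1
  have h10 := M.2.2 1 0 (by decide)
  have h20 := M.2.2 2 0 (by decide)
  have h21 := M.2.2 2 1 (by decide)
  fin_cases i <;> fin_cases j <;> simp [heisenbergMk, h1, h10, h20, h21]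

theorem zpow_left (a : ℝ) (k : ℤ) : thetaMk a 0 0 ^ k = thetaMk (k * a) 0 0 := by
  induction k using Int.induction_on with
  | zero => simp [one]
  | succ k ih => rw [zpow_add_one, ih, mul, eq_iff]; push_cast; refine ⟨by ring, by ring, by ring⟩
  | pred k ih =>
    rw [zpow_sub_one, ih, inv, mul, eq_iff]; push_cast; refine ⟨by ring, by ring, by ring⟩

theorem zpow_middle (b : ℝ) (k : ℤ) : thetaMk 0 b 0 ^ k = thetaMk 0 (k * b) 0 := by
  induction k using Int.induction_on with
  | zero => simp [one]
  | succ k ih => rw [zpow_add_one, ih, mul, eq_iff]; push_cast; refine ⟨by ring, by ring, by ring⟩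
  | pred k ih =>
    rw [zpow_sub_one, ih, inv, mul, eq_iff]; push_cast; refine ⟨by ring, by ring, by ring⟩

theorem zpow_right (c : ℝ) (k : ℤ) : thetaMk 0 0 c ^ k = thetaMk 0 0 (k * c) := by
  induction k using Int.induction_on with
  | zero => simp [one]
  | succ k ih => rw [zpow_add_one, ih, mul, eq_iff]; push_cast; refine ⟨by ring, by ring, by ring⟩
  | pred k ih =>
    rw [zpow_sub_one, ih, inv, mul, eq_iff]; push_cast; refine ⟨by ring, by ring, by ring⟩

theorem isNilpotent_sub_one (a b c : ℝ) : IsNilpotent (thetaMatrix a b c - 1) := by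
  have htri : (thetaMatrix a b c - 1).IsUpperTriangular := by
    intro i j h
    fin_cases i <;> fin_cases j <;>
      first | (simp [thetaMatrix]; done) | (exact absurd h (by decide))
  refine ⟨10, ?_⟩
  -- By Cayley–Hamilton: a strictly upper-triangular matrix has characteristic polynomial X¹⁰.
  have h := Matrix.aeval_self_charpoly (thetaMatrix a b c - 1)
  have hd : ∀ i, (thetaMatrix a b c - 1) i i = 0 := by
    intro i
    fin_cases i <;> simp [thetaMatrix]
  rw [Matrix.charpoly_of_isUpperTriangular _ htri] at h
  simpa [hd] using h

end thetaMk

/-! ### The integral lattice -/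

/-- The subgroup of `G` of elements with integral coordinates. -/
def integralTheta : Subgroup thetaGroup where
  carrier := {g | ∃ i j k : ℤ, g = thetaMk i j k}
  one_mem' := ⟨0, 0, 0, by simp [thetaMk.one]⟩
  mul_mem' := by
    rintro _ _ ⟨i, j, k, rfl⟩ ⟨i', j', k', rfl⟩
    exact ⟨i + i', j + j', k + k' + i * j', by rw [thetaMk.mul]; push_cast; rfl⟩
  inv_mem' := by
    rintro _ ⟨i, j, k, rfl⟩
    exact ⟨-i, -j, i * j - k, by rw [thetaMk.inv]; push_cast; rfl⟩

namespace integralTheta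

/-- The element of the integral lattice with given coordinates. -/
def mk (i j k : ℤ) : integralTheta := ⟨thetaMk i j k, i, j, k, rfl⟩

theorem exists_eq (γ : integralTheta) : ∃ i j k, γ = mk i j k := by
  obtain ⟨_, i, j, k, rfl⟩ := γ
  exact ⟨i, j, k, rfl⟩

theorem mk_mul (i j k i' j' k' : ℤ) :
    mk i j k * mk i' j' k' = mk (i + i') (j + j') (k + k' + i * j') := by
  apply Subtype.ext
  simp only [mk, Subgroup.coe_mul, thetaMk.mul]
  push_cast
  rfl

theorem mk_inv (i j k : ℤ) : (mk i j k)⁻¹ = mk (-i) (-j) (i * j - k) := by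
  apply Subtype.ext
  simp only [mk, Subgroup.coe_inv, thetaMk.inv]
  push_cast
  rfl

theorem mk_eq_iff {i j k i' j' k' : ℤ} : mk i j k = mk i' j' k' ↔ i = i' ∧ j = j' ∧ k = k' := by
  rw [Subtype.ext_iff]
  simp only [mk, thetaMk.eq_iff]
  norm_cast

theorem mk_zero : mk 0 0 0 = 1 := by
  have h := mk_mul 0 0 0 0 0 0
  simp only [add_zero, mul_zero] at h
  exact mul_eq_left.mp h

theorem mk_zpow_left (n : ℤ) : mk 1 0 0 ^ n = mk n 0 0 := by
  apply Subtype.ext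
  have := thetaMk.zpow_left 1 n
  simp only [mk, Subgroup.coe_zpow]
  simpa using this

theorem mk_zpow_middle (n : ℤ) : mk 0 1 0 ^ n = mk 0 n 0 := by
  apply Subtype.ext
  have := thetaMk.zpow_middle 1 n
  simp only [mk, Subgroup.coe_zpow]
  simpa using this

theorem mk_zpow_right (n : ℤ) : mk 0 0 1 ^ n = mk 0 0 n := by
  apply Subtype.ext
  have := thetaMk.zpow_right 1 n
  simp only [mk, Subgroup.coe_zpow]
  simpa using this

theorem commutator_mk (i j k i' j' k' : ℤ) :
    ⁅mk i j k, mk i' j' k'⁆ = mk 0 0 (i * j' - i' * j) := by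
  rw [commutatorElement_def, mk_inv, mk_inv, mk_mul, mk_mul, mk_mul, mk_eq_iff]
  refine ⟨by ring, by ring, by ring⟩

theorem isNilpotent : Group.IsNilpotent integralTheta := by
  refine ⟨2, ?_⟩
  rw [eq_top_iff]
  intro γ _
  rw [Subgroup.mem_upperCentralSeries_succ_iff]
  intro γ'
  rw [Subgroup.mem_upperCentralSeries_succ_iff]
  intro γ''
  obtain ⟨i, j, k, rfl⟩ := exists_eq γ
  obtain ⟨i', j', k', rfl⟩ := exists_eq γ'
  obtain ⟨i'', j'', k'', rfl⟩ := exists_eq γ''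
  simp [commutator_mk, mk_zero]

/-- A finite-index subgroup contains positive powers of both generators, with exponents m and n say,
and their commutator has central coordinate mn ≠ 0. -/
theorem not_isVirtuallyAbelian : ¬ IsVirtuallyAbelian integralTheta := by
  rintro ⟨N, hN, hcomm⟩
  obtain ⟨m, hm0, -, hm⟩ := Subgroup.exists_pow_mem_of_index_ne_zero hN.index_ne_zero (mk 1 0 0)
  obtain ⟨n, hn0, -, hn⟩ := Subgroup.exists_pow_mem_of_index_ne_zero hN.index_ne_zero (mk 0 1 0)
  have h := hcomm _ hm _ hn
  rw [← zpow_natCast, ← zpow_natCast, mk_zpow_left, mk_zpow_middle, mk_mul, mk_mul,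
    mk_eq_iff] at h
  have h3 := h.2.2
  simp at h3
  omega

end integralTheta

/-! ### The presentation -/

/-- In a group where `z = [x, y]` commutes with `x` and `y`, powers of `x` and `y` commute up to a
power of `z`. -/
theorem zpow_mul_zpow_of_central_commutator {G : Type*} [Group G] {x y : G}
    (hx : Commute x ⁅x, y⁆) (hy : Commute y ⁅x, y⁆) (i j : ℤ) :
    x ^ i * y ^ j = y ^ j * x ^ i * ⁅x, y⁆ ^ (i * j) := by
  set z := ⁅x, y⁆ with hz
  have h1 : x * y * x⁻¹ = y * z := by
    rw [hy.eq, hz, commutatorElement_def]; group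
  have h2 : ∀ j : ℤ, x * y ^ j * x⁻¹ = y ^ j * z ^ j := by
    intro j
    rw [← hy.mul_zpow, ← h1, conj_zpow]
  have h3 : ∀ j : ℤ, y ^ (-j) * x * y ^ j = x * z ^ j := by
    intro j
    have h := h2 j
    rw [mul_inv_eq_iff_eq_mul] at h
    rw [mul_assoc, h, zpow_neg, mul_assoc, inv_mul_cancel_left, (hx.zpow_right j).eq]
  have h4 : y ^ (-j) * x ^ i * y ^ j = x ^ i * z ^ (i * j) := by
    have : y ^ (-j) * x ^ i * y ^ j = (y ^ (-j) * x * (y ^ (-j))⁻¹) ^ i := by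
      rw [conj_zpow, zpow_neg, inv_inv]
    rw [this, zpow_neg, inv_inv, ← zpow_neg, h3, (hx.zpow_right j).mul_zpow, ← zpow_mul,
      mul_comm j i]
  rw [mul_assoc, ← h4, zpow_neg]
  group

namespace integralTheta

theorem lift_heisenbergRels (r : FreeGroup (Fin 2)) (hr : r ∈ heisenbergRels) :
    FreeGroup.lift ![mk 1 0 0, mk 0 1 0] r = 1 := by
  simp only [heisenbergRels, Set.mem_insert_iff, Set.mem_singleton_iff] at hr
  rcases hr with rfl | rfl <;>
    simp [map_commutatorElement, commutator_mk, ← mk_zero]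

/-- The relators make [x, y] central, so every word collects to yʲ xⁱ [x, y]ᵏ. In this order the
image in the lattice is exactly `mk i j k`, with no correction term, so the exponents can be read
off and the map is injective. -/
theorem nonempty_mulEquiv_presentedGroup :
    Nonempty (integralTheta ≃* PresentedGroup heisenbergRels) := by
  set x : PresentedGroup heisenbergRels := PresentedGroup.of 0 with hx
  set y : PresentedGroup heisenbergRels := PresentedGroup.of 1 with hy
  have hxz : Commute x ⁅x, y⁆ := by
    rw [← commutatorElement_eq_one_iff_commute]
    exact PresentedGroup.one_of_mem (rels := heisenbergRels)
      (x := ⁅FreeGroup.of (0 : Fin 2), ⁅FreeGroup.of (0 : Fin 2), FreeGroup.of (1 : Fin 2)⁆⁆)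
      (by simp [heisenbergRels])
  have hyz : Commute y ⁅x, y⁆ := by
    rw [← commutatorElement_eq_one_iff_commute]
    exact PresentedGroup.one_of_mem (rels := heisenbergRels)
      (x := ⁅FreeGroup.of (1 : Fin 2), ⁅FreeGroup.of (0 : Fin 2), FreeGroup.of (1 : Fin 2)⁆⁆)
      (by simp [heisenbergRels])
  set F : PresentedGroup heisenbergRels →* integralTheta :=
    PresentedGroup.toGroup lift_heisenbergRels with hF
  have hFx : F x = mk 1 0 0 := by simp [hF, hx]
  have hFy : F y = mk 0 1 0 := by simp [hF, hy]
  have hFn : ∀ i j k : ℤ, F (y ^ j * x ^ i * ⁅x, y⁆ ^ k) = mk i j k := by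
    intro i j k
    simp only [map_mul, map_zpow, map_commutatorElement, hFx, hFy, commutator_mk]
    simp [mk_zpow_left, mk_zpow_middle, mk_zpow_right, mk_mul]
  have hmul : ∀ i j k i' j' k' : ℤ,
      y ^ j * x ^ i * ⁅x, y⁆ ^ k * (y ^ j' * x ^ i' * ⁅x, y⁆ ^ k') =
        y ^ (j + j') * x ^ (i + i') * ⁅x, y⁆ ^ (k + k' + i * j') := by
    intro i j k i' j' k'
    have key := zpow_mul_zpow_of_central_commutator hxz hyz i j'
    have c1 : ∀ m n : ℤ, x ^ m * ⁅x, y⁆ ^ n = ⁅x, y⁆ ^ n * x ^ m :=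
      fun m n => (hxz.zpow_zpow m n).eq
    have c2 : ∀ m n : ℤ, y ^ m * ⁅x, y⁆ ^ n = ⁅x, y⁆ ^ n * y ^ m :=
      fun m n => (hyz.zpow_zpow m n).eq
    calc y ^ j * x ^ i * ⁅x, y⁆ ^ k * (y ^ j' * x ^ i' * ⁅x, y⁆ ^ k')
        = y ^ j * (x ^ i * (⁅x, y⁆ ^ k * y ^ j')) * x ^ i' * ⁅x, y⁆ ^ k' := by group
      _ = y ^ j * (x ^ i * y ^ j') * (⁅x, y⁆ ^ k * x ^ i') * ⁅x, y⁆ ^ k' := by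
        rw [← c2]; simp only [mul_assoc]
      _ = y ^ j * y ^ j' * x ^ i * (⁅x, y⁆ ^ (i * j') * x ^ i') * ⁅x, y⁆ ^ k * ⁅x, y⁆ ^ k' := by
        rw [key, ← c1]; simp only [mul_assoc]
      _ = y ^ (j + j') * x ^ (i + i') * ⁅x, y⁆ ^ (k + k' + i * j') := by
        rw [← c1, zpow_add y, zpow_add x, show k + k' + i * j' = i * j' + k + k' by ring,
          zpow_add ⁅x, y⁆, zpow_add ⁅x, y⁆]
        simp only [mul_assoc]
  have hnf : ∀ w : PresentedGroup heisenbergRels, ∃ i j k : ℤ, w = y ^ j * x ^ i * ⁅x, y⁆ ^ k := by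
    let N : Subgroup (PresentedGroup heisenbergRels) :=
      { carrier := {w | ∃ i j k : ℤ, w = y ^ j * x ^ i * ⁅x, y⁆ ^ k}
        one_mem' := ⟨0, 0, 0, by simp⟩
        mul_mem' := by
          rintro _ _ ⟨i, j, k, rfl⟩ ⟨i', j', k', rfl⟩
          exact ⟨_, _, _, hmul i j k i' j' k'⟩
        inv_mem' := by
          rintro _ ⟨i, j, k, rfl⟩
          refine ⟨-i, -j, i * j - k, ?_⟩
          rw [inv_eq_iff_mul_eq_one, hmul]
          simp }
    refine PresentedGroup.generated_by heisenbergRels N fun l => ?_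
    fin_cases l
    · exact ⟨1, 0, 0, by simp [hx]⟩
    · exact ⟨0, 1, 0, by simp [hy]⟩
  refine ⟨(MulEquiv.ofBijective F ⟨?_, ?_⟩).symm⟩
  · intro u v huv
    obtain ⟨i, j, k, rfl⟩ := hnf u
    obtain ⟨i', j', k', rfl⟩ := hnf v
    rw [hFn, hFn, mk_eq_iff] at huv
    obtain ⟨rfl, rfl, rfl⟩ := huv
    rfl
  · intro γ
    obtain ⟨i, j, k, rfl⟩ := exists_eq γ
    exact ⟨_, hFn i j k⟩

end integralTheta

/-! ### A strictly convex penalty function -/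

/-- If |x| ≠ |y|, strictness comes from the power function on the half-line; if y = -x, it comes
from the triangle inequality. -/
theorem strictConvexOn_abs_rpow {p : ℝ} (hp : 1 < p) :
    StrictConvexOn ℝ Set.univ fun x : ℝ => |x| ^ p := by
  refine ⟨convex_univ, fun x _ y _ hxy a b ha hb hab => ?_⟩
  have hp0 : 0 < p := by linarith
  simp only [smul_eq_mul]
  have habs : |a * x + b * y| ≤ a * |x| + b * |y| := by
    refine (abs_add_le _ _).trans_eq ?_
    rw [abs_mul, abs_mul, abs_of_pos ha, abs_of_pos hb]
  by_cases h : |x| = |y|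
  · have hy : y = -x := by
      rcases abs_eq_abs.mp h with h | h
      · exact absurd h hxy
      · rw [h, neg_neg]
    have hx : 0 < |x| := abs_pos.mpr fun hx => hxy (by rw [hy, hx, neg_zero])
    have hlt : |a * x + b * y| < |x| := by
      rw [hy, show a * x + b * -x = (a - b) * x by ring, abs_mul]
      have : |a - b| < 1 := by rw [abs_lt]; constructor <;> linarith
      nlinarith
    calc |a * x + b * y| ^ p < |x| ^ p := Real.rpow_lt_rpow (abs_nonneg _) hlt hp0
      _ = a * |x| ^ p + b * |y| ^ p := by rw [← h, ← add_mul, hab, one_mul]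
  · calc |a * x + b * y| ^ p ≤ (a * |x| + b * |y|) ^ p :=
        Real.rpow_le_rpow (abs_nonneg _) habs hp0.le
      _ < a * |x| ^ p + b * |y| ^ p :=
        (strictConvexOn_rpow hp).2 (abs_nonneg x) (abs_nonneg y) h ha hb hab

/-- The sum of the powers of order `5 / 4` of all homogeneous coordinates but the first and the
last. -/
def penalty (v : Fin 10 → ℝ) : ℝ := ∑ i : Fin 8, |v i.succ.castSucc| ^ (5 / 4 : ℝ)

theorem penalty_nonneg (v : Fin 10 → ℝ) : 0 ≤ penalty v :=
  Finset.sum_nonneg fun _ _ => by positivity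

theorem abs_rpow_le_penalty (v : Fin 10 → ℝ) (i : Fin 8) :
    |v i.succ.castSucc| ^ (5 / 4 : ℝ) ≤ penalty v :=
  Finset.single_le_sum (f := fun i : Fin 8 => |v i.succ.castSucc| ^ (5 / 4 : ℝ))
    (fun _ _ => by positivity) (Finset.mem_univ i)

theorem continuous_penalty : Continuous penalty := by
  refine continuous_finsetSum _ fun i _ => ?_
  exact (continuous_apply _).abs.rpow_const fun _ => Or.inr (by norm_num)

theorem penalty_congr {u v : Fin 10 → ℝ} (h : ∀ i : Fin 8, u i.succ.castSucc = v i.succ.castSucc) :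
    penalty u = penalty v := by
  simp only [penalty, h]

theorem convexOn_penalty : ConvexOn ℝ Set.univ penalty := by
  refine ⟨convex_univ, fun u _ v _ a b ha hb hab => ?_⟩
  simp only [penalty, Finset.smul_sum, ← Finset.sum_add_distrib]
  exact Finset.sum_le_sum fun i _ => (strictConvexOn_abs_rpow (by norm_num)).convexOn.2
    (Set.mem_univ _) (Set.mem_univ _) ha hb hab

/-- The epigraph of the penalty function is strictly convex. -/
theorem penalty_combo_lt {u v : Fin 10 → ℝ} (huv : u ≠ v) (h9 : u (Fin.last 9) = v (Fin.last 9))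
    (hu : penalty u ≤ u 0) (hv : penalty v ≤ v 0) {a b : ℝ} (ha : 0 < a) (hb : 0 < b)
    (hab : a + b = 1) : penalty (a • u + b • v) < (a • u + b • v) 0 := by
  -- The penalty does not see the first coordinate. Two points on a common vertical line have
  -- different heights, so the higher one is strictly above the graph; otherwise the penalty itself
  -- is strictly convex between them.
  by_cases h : ∀ i : Fin 8, u i.succ.castSucc = v i.succ.castSucc
  · have h0 : u 0 ≠ v 0 := by
      intro h0
      refine huv (funext fun i => ?_)
      refine Fin.lastCases h9 (fun i => ?_) i
      exact Fin.cases h0 h i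
    have e1 : penalty (a • u + b • v) = penalty u := penalty_congr fun i => by
      rw [Pi.add_apply, Pi.smul_apply, Pi.smul_apply, ← h i, ← add_smul, hab, one_smul]
    have e2 : penalty u = penalty v := penalty_congr h
    rw [e1]
    simp only [Pi.add_apply, Pi.smul_apply, smul_eq_mul]
    rw [← e2] at hv
    have e3 : penalty u = a * penalty u + b * penalty u := by rw [← add_mul, hab, one_mul]
    have ha' := mul_le_mul_of_nonneg_left hu ha.le
    have hb' := mul_le_mul_of_nonneg_left hv hb.le
    rcases h0.lt_or_gt with h0 | h0
    · have := mul_lt_mul_of_pos_left (hu.trans_lt h0) hb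
      linarith
    · have := mul_lt_mul_of_pos_left (hv.trans_lt h0) ha
      linarith
  · push Not at h
    obtain ⟨j, hj⟩ := h
    calc penalty (a • u + b • v) < a * penalty u + b * penalty v := by
          simp only [penalty, Finset.mul_sum, ← Finset.sum_add_distrib]
          have hs := strictConvexOn_abs_rpow (p := 5 / 4) (by norm_num)
          refine Finset.sum_lt_sum (fun i _ => ?_) ⟨j, Finset.mem_univ _, ?_⟩
          · exact hs.convexOn.2 (Set.mem_univ _) (Set.mem_univ _) ha.le hb.le hab
          · exact hs.2 (Set.mem_univ _) (Set.mem_univ _) hj ha hb hab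
      _ ≤ a * u 0 + b * v 0 := by gcongr
      _ = (a • u + b • v) 0 := by simp

/-! ### Coercivity of the action -/

theorem thetaMk_smul (a b c : ℝ) (v : Fin 10 → ℝ) :
    thetaMk a b c • v = (thetaMatrix a b c).mulVec v := rfl

theorem continuous_thetaMatrix :
    Continuous fun x : ℝ × ℝ × ℝ => thetaMatrix x.1 x.2.1 x.2.2 := by
  refine continuous_matrix fun i j => ?_
  fin_cases i <;> fin_cases j <;> simp [thetaMatrix] <;> fun_prop

theorem continuous_thetaMk_smul :
    Continuous fun x : (ℝ × ℝ × ℝ) × (Fin 10 → ℝ) => thetaMk x.1.1 x.1.2.1 x.1.2.2 • x.2 := by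
  simp only [thetaMk_smul]
  exact (continuous_thetaMatrix.comp continuous_fst).matrix_mulVec continuous_snd

set_option maxHeartbeats 1000000 in
-- All entries except the top right one have weight at most 3. The condition 1 ≤ m absorbs the lower
-- powers, and the factor 3 the numerical coefficients.
theorem abs_thetaMatrix_le {a b c m : ℝ} (hm : 1 ≤ m) (ha : |a| ≤ m) (hb : |b| ≤ m)
    (hc : |c| ≤ m ^ 2) (i j : Fin 10) (hij : i ≠ 0 ∨ j ≠ Fin.last 9) :
    |thetaMatrix a b c i j| ≤ 3 * m ^ 3 := by
  have hm0 : 0 ≤ m := by linarith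
  have m2 : m ≤ m ^ 2 := by nlinarith
  have m3 : m ^ 2 ≤ m ^ 3 := by nlinarith [sq_nonneg m]
  have key : ∀ {x : ℝ} {y : ℝ}, |x| ≤ m → |y| ≤ m ^ 2 → |x * y| ≤ m ^ 3 := by
    intro x y hx hy
    rw [abs_mul]
    calc |x| * |y| ≤ m * m ^ 2 := by gcongr
      _ = m ^ 3 := by ring
  have a2 : |a ^ 2| ≤ m ^ 2 := by rw [abs_pow]; gcongr
  have b2 : |b ^ 2| ≤ m ^ 2 := by rw [abs_pow]; gcongr
  have ab : |a * b| ≤ m ^ 2 := by rw [abs_mul, sq]; gcongr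
  have a3 := key ha a2
  have b3 := key hb b2
  have ac := key ha hc
  have bc := key hb hc
  rw [abs_le] at *
  obtain ⟨_, _⟩ := ha
  obtain ⟨_, _⟩ := hb
  obtain ⟨_, _⟩ := hc
  obtain ⟨_, _⟩ := a2
  obtain ⟨_, _⟩ := b2
  obtain ⟨_, _⟩ := ab
  obtain ⟨_, _⟩ := a3
  obtain ⟨_, _⟩ := b3
  obtain ⟨_, _⟩ := ac
  obtain ⟨_, _⟩ := bc
  clear key
  fin_cases i <;> fin_cases j <;>
    first
    | (exact absurd hij (by decide))
    | (simp [thetaMatrix]; done)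
    | (simp [thetaMatrix]; constructor <;> linarith)
    | (simp [thetaMatrix]; linarith)

theorem succ_castSucc_ne_zero : ∀ i : Fin 8, i.succ.castSucc ≠ (0 : Fin 10) := by decide

theorem abs_sum_mul_le {ι : Type*} [Fintype ι] {f v : ι → ℝ} {A R : ℝ} (hA : 0 ≤ A)
    (hf : ∀ i, |f i| ≤ A) (hv : ∀ i, |v i| ≤ R) :
    |∑ i, f i * v i| ≤ Fintype.card ι * (A * R) := by
  calc |∑ i, f i * v i| ≤ ∑ i, |f i * v i| := Finset.abs_sum_le_sum_abs _ _
    _ ≤ ∑ _i : ι, A * R := Finset.sum_le_sum fun i _ => by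
        rw [abs_mul]
        exact mul_le_mul (hf i) (hv i) (abs_nonneg _) hA
    _ = Fintype.card ι * (A * R) := by simp

theorem penalty_thetaMk_smul_le {a b c m R : ℝ} (hm : 1 ≤ m) (ha : |a| ≤ m) (hb : |b| ≤ m)
    (hc : |c| ≤ m ^ 2) (hR : 0 ≤ R) {v : Fin 10 → ℝ} (hv : ∀ i, |v i| ≤ R) :
    penalty (thetaMk a b c • v) ≤ 8 * (30 * R) ^ (5 / 4 : ℝ) * m ^ (15 / 4 : ℝ) := by
  have hm0 : 0 ≤ m := by linarith
  have h1 : ∀ i : Fin 8, |(thetaMk a b c • v) i.succ.castSucc| ^ (5 / 4 : ℝ) ≤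
      (30 * R) ^ (5 / 4 : ℝ) * m ^ (15 / 4 : ℝ) := by
    intro i
    have h2 : |(thetaMk a b c • v) i.succ.castSucc| ≤ 30 * R * m ^ 3 := by
      rw [thetaMk_smul, Matrix.mulVec, dotProduct]
      -- Ten summands of size at most 3m³R give the constant 30; raising to the power 5/4 turns m³
      -- into m^(15/4).
      refine (abs_sum_mul_le (A := 3 * m ^ 3) (by positivity) (fun j => ?_) hv).trans_eq ?_
      · exact abs_thetaMatrix_le hm ha hb hc _ _ (Or.inl (succ_castSucc_ne_zero i))
      · simp; ring
    calc _ ≤ (30 * R * m ^ 3) ^ (5 / 4 : ℝ) :=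
          Real.rpow_le_rpow (abs_nonneg _) h2 (by norm_num)
      _ = _ := by
          rw [Real.mul_rpow (by positivity) (by positivity), ← Real.rpow_natCast m 3,
            ← Real.rpow_mul hm0]
          norm_num
  calc penalty (thetaMk a b c • v) ≤ ∑ _i : Fin 8, (30 * R) ^ (5 / 4 : ℝ) * m ^ (15 / 4 : ℝ) :=
        Finset.sum_le_sum fun i _ => h1 i
    _ = _ := by simp; ring

/-- The weight 4 entry multiplies the last coordinate 1; the other nine entries of the first row
contribute at most 9 · 3m³R. -/
theorem le_thetaMk_smul_zero {a b c m R : ℝ} (hm : 1 ≤ m) (ha : |a| ≤ m) (hb : |b| ≤ m)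
    (hc : |c| ≤ m ^ 2) {v : Fin 10 → ℝ} (hv : ∀ i, |v i| ≤ R)
    (h9 : v (Fin.last 9) = 1) :
    (a ^ 4 + b ^ 4) / 24 + c ^ 2 - 27 * R * m ^ 3 ≤ (thetaMk a b c • v) 0 := by
  have hm0 : 0 ≤ m := by linarith
  rw [thetaMk_smul, Matrix.mulVec, dotProduct, Fin.sum_univ_castSucc, h9]
  have h := abs_sum_mul_le (f := fun j : Fin 9 => thetaMatrix a b c 0 j.castSucc)
    (v := fun j : Fin 9 => v j.castSucc) (A := 3 * m ^ 3) (by positivity)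
    (fun j => abs_thetaMatrix_le hm ha hb hc _ _ (Or.inr (Fin.castSucc_lt_last j).ne))
    (fun j => hv _)
  have h2 : thetaMatrix a b c 0 (Fin.last 9) = (a ^ 4 + b ^ 4) / 24 + c ^ 2 := rfl
  rw [h2]
  have h3 := (abs_le.mp h).1
  simp only [Fintype.card_fin] at h3
  push_cast at h3
  linarith

/-- For vectors in a bounded part of an affine patch, only a bounded set of group elements is
relevant for the inequality defining the domain. -/
theorem exists_bound_penalty_lt (R : ℝ) (hR : 0 ≤ R) :
    ∃ M : ℝ, ∀ a b c : ℝ, ∀ v : Fin 10 → ℝ, (∀ i, |v i| ≤ R) → v (Fin.last 9) = 1 →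
      M < |a| ∨ M < |b| ∨ M < |c| → penalty (thetaMk a b c • v) < (thetaMk a b c • v) 0 := by
  -- Chosen so that m^(1/4) > L makes m⁴/24 exceed the penalty bound plus the error 27Rm³.
  set L : ℝ := 24 * (8 * (30 * R) ^ (5 / 4 : ℝ) + 27 * R) with hL
  have hL0 : 0 ≤ L := by positivity
  -- The square is needed because |c| is only bounded by m².
  refine ⟨(max 1 (L ^ 4)) ^ 2, fun a b c v hv h9 habc => ?_⟩
  set M := max 1 (L ^ 4) with hM
  have hM1 : 1 ≤ M := le_max_left _ _
  set m := max (max |a| |b|) (Real.sqrt |c|) with hmdef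
  have ha : |a| ≤ m := (le_max_left _ _).trans (le_max_left _ _)
  have hb : |b| ≤ m := (le_max_right _ _).trans (le_max_left _ _)
  have hc' : Real.sqrt |c| ≤ m := le_max_right _ _
  have hm0 : 0 ≤ m := (abs_nonneg a).trans ha
  have hc : |c| ≤ m ^ 2 := (Real.sqrt_le_left hm0).mp hc'
  have hMm : M < m := by
    rcases habc with h | h | h
    · nlinarith
    · nlinarith
    · have : M ^ 2 < m ^ 2 := h.trans_le hc
      exact lt_of_pow_lt_pow_left₀ 2 hm0 this
  have hm1 : 1 ≤ m := hM1.trans hMm.le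
  have hm4 : m ^ 4 / 24 ≤ (a ^ 4 + b ^ 4) / 24 + c ^ 2 := by
    have ha4 : 0 ≤ a ^ 4 := by positivity
    have hb4 : 0 ≤ b ^ 4 := by positivity
    have hc2 : 0 ≤ c ^ 2 := by positivity
    rcases max_choice (max |a| |b|) (Real.sqrt |c|) with h | h
    · rcases max_choice |a| |b| with h' | h'
      · have : m ^ 4 = a ^ 4 := by rw [hmdef, h, h', pow_abs, abs_of_nonneg ha4]
        linarith
      · have : m ^ 4 = b ^ 4 := by rw [hmdef, h, h', pow_abs, abs_of_nonneg hb4]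
        linarith
    · have : m ^ 4 = c ^ 2 := by
        rw [hmdef, h, show (4 : ℕ) = 2 * 2 by norm_num, pow_mul, Real.sq_sqrt (abs_nonneg c),
          sq_abs]
      linarith
  have hmpos : 0 < m := by linarith
  have hroot : L < m ^ (1 / 4 : ℝ) := by
    have h1 : L ^ 4 < m := (le_max_right _ _).trans_lt hMm
    calc L = (L ^ 4) ^ (1 / 4 : ℝ) := by
          rw [← Real.rpow_natCast L 4, ← Real.rpow_mul hL0]; norm_num
      _ < m ^ (1 / 4 : ℝ) := Real.rpow_lt_rpow (by positivity) h1 (by norm_num)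
  have hsplit : m ^ 4 = m ^ (15 / 4 : ℝ) * m ^ (1 / 4 : ℝ) := by
    rw [← Real.rpow_add hmpos, ← Real.rpow_natCast m 4]; norm_num
  have hcube : m ^ 3 ≤ m ^ (15 / 4 : ℝ) := by
    rw [← Real.rpow_natCast m 3]
    exact Real.rpow_le_rpow_of_exponent_le hm1 (by norm_num)
  have hpos : 0 < m ^ (15 / 4 : ℝ) := by positivity
  have h1 := penalty_thetaMk_smul_le hm1 ha hb hc hR hv
  have h2 := le_thetaMk_smul_zero hm1 ha hb hc hv h9
  have h3 : 27 * R * m ^ 3 ≤ 27 * R * m ^ (15 / 4 : ℝ) := by gcongr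
  have h4 : m ^ (15 / 4 : ℝ) * L < m ^ (15 / 4 : ℝ) * m ^ (1 / 4 : ℝ) := by gcongr
  rw [hL] at h4
  linarith

/-! ### The domain -/

/-- The vectors all of whose translates lie strictly above the graph of the penalty function. -/
def strictCap : Set (Fin 10 → ℝ) := {v | ∀ g : thetaGroup, penalty (g • v) < (g • v) 0}

/-- The vectors all of whose translates lie above the graph of the penalty function. -/
def weakCap : Set (Fin 10 → ℝ) := {v | ∀ g : thetaGroup, penalty (g • v) ≤ (g • v) 0}

theorem strictCap_subset_weakCap : strictCap ⊆ weakCap := fun _ hv g => (hv g).le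

theorem smul_mem_strictCap {v : Fin 10 → ℝ} (hv : v ∈ strictCap) (g : thetaGroup) :
    g • v ∈ strictCap := fun h => by
  rw [← mul_smul]
  exact hv _

theorem smul_last (g : thetaGroup) (v : Fin 10 → ℝ) : (g • v) (Fin.last 9) = v (Fin.last 9) := by
  obtain ⟨a, b, c, rfl⟩ := thetaMk.exists_eq g
  rw [thetaMk_smul, show Fin.last 9 = 9 from rfl]
  simp [thetaMatrix, Matrix.mulVec, dotProduct, Fin.sum_univ_succ]

theorem continuous_smul_thetaGroup (g : thetaGroup) : Continuous fun v : Fin 10 → ℝ => g • v := by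
  obtain ⟨a, b, c, rfl⟩ := thetaMk.exists_eq g
  exact continuous_thetaMk_smul.comp (f := fun v => ((a, b, c), v)) (by fun_prop)

/-- Each group element acts linearly and injectively and keeps the last coordinate, so strict
convexity of the epigraph applies to every translate separately. -/
theorem combo_mem_strictCap {u v : Fin 10 → ℝ} (huv : u ≠ v)
    (h9 : u (Fin.last 9) = v (Fin.last 9)) (hu : u ∈ weakCap) (hv : v ∈ weakCap) {a b : ℝ}
    (ha : 0 < a) (hb : 0 < b) (hab : a + b = 1) : a • u + b • v ∈ strictCap := by
  intro g
  rw [smul_add, smul_comm g a, smul_comm g b]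
  refine penalty_combo_lt ?_ ?_ (hu g) (hv g) ha hb hab
  · exact fun h => huv (smul_left_cancel g h)
  · rw [smul_last, smul_last, h9]

theorem convex_strictCap : Convex ℝ strictCap := by
  intro u hu v hv a b ha hb hab g
  rw [smul_add, smul_comm g a, smul_comm g b]
  calc penalty (a • g • u + b • g • v) ≤ a * penalty (g • u) + b * penalty (g • v) :=
        convexOn_penalty.2 (Set.mem_univ _) (Set.mem_univ _) ha hb hab
    _ < a * (g • u) 0 + b * (g • v) 0 := by
        have h1 := hu g
        have h2 := hv g
        rcases ha.eq_or_lt with rfl | ha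
        · obtain rfl : b = 1 := by linarith
          linarith
        · have := mul_lt_mul_of_pos_left h1 ha
          have := mul_le_mul_of_nonneg_left h2.le hb
          linarith
    _ = (a • g • u + b • g • v) 0 := by simp

theorem isCompact_cube (M : ℝ) :
    IsCompact (Set.Icc (-M) M ×ˢ Set.Icc (-M) M ×ˢ Set.Icc (-M) M) :=
  isCompact_Icc.prod (isCompact_Icc.prod isCompact_Icc)

/-- On the unit ball around `v`, group elements outside one compact cube impose no condition; for
those inside, the open condition persists near `v` by the tube lemma. -/
theorem strictCap_mem_nhds {v : Fin 10 → ℝ} (hv : v ∈ strictCap) :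
    ∀ᶠ w in 𝓝 v, w (Fin.last 9) = 1 → w ∈ strictCap := by
  obtain ⟨M, hM⟩ := exists_bound_penalty_lt (‖v‖ + 1) (by positivity)
  have h1 : ∀ᶠ w in 𝓝 v, ∀ x ∈ Set.Icc (-M) M ×ˢ Set.Icc (-M) M ×ˢ Set.Icc (-M) M,
      penalty (thetaMk x.1 x.2.1 x.2.2 • w) < (thetaMk x.1 x.2.1 x.2.2 • w) 0 := by
    refine (isCompact_cube M).eventually_forall_of_forall_eventually fun x _ => ?_
    have hc : Continuous fun z : (Fin 10 → ℝ) × (ℝ × ℝ × ℝ) =>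
        thetaMk z.2.1 z.2.2.1 z.2.2.2 • z.1 :=
      continuous_thetaMk_smul.comp (f := fun z : (Fin 10 → ℝ) × (ℝ × ℝ × ℝ) => (z.2, z.1))
        (by fun_prop)
    have h2 : IsOpen {z : (Fin 10 → ℝ) × (ℝ × ℝ × ℝ) |
        penalty (thetaMk z.2.1 z.2.2.1 z.2.2.2 • z.1) < (thetaMk z.2.1 z.2.2.1 z.2.2.2 • z.1) 0} :=
      isOpen_lt (continuous_penalty.comp hc) ((continuous_apply 0).comp hc)
    exact h2.mem_nhds (hv _)
  filter_upwards [h1, Metric.ball_mem_nhds v one_pos] with w hw hball h9 g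
  obtain ⟨a, b, c, rfl⟩ := thetaMk.exists_eq g
  have hR : ∀ i, |w i| ≤ ‖v‖ + 1 := by
    intro i
    have h3 : ‖w‖ ≤ ‖v‖ + ‖w - v‖ := by simpa using norm_add_le v (w - v)
    have h4 : ‖w - v‖ < 1 := by simpa [dist_eq_norm] using hball
    have h5 : |w i| ≤ ‖w‖ := norm_le_pi_norm w i
    linarith
  by_cases h : M < |a| ∨ M < |b| ∨ M < |c|
  · exact hM a b c w hR h9 h
  · push Not at h
    exact hw (a, b, c) ⟨abs_le.mp h.1, abs_le.mp h.2.1, abs_le.mp h.2.2⟩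

theorem thetaMk_smul_single_zero (a b c x : ℝ) :
    thetaMk a b c • (Pi.single 0 x : Fin 10 → ℝ) = Pi.single 0 x := by
  rw [thetaMk_smul]
  ext i
  fin_cases i <;> simp [thetaMatrix]

/-- Adding a multiple of the `G`-fixed first basis vector raises all translates by the same height
without changing their penalties. For the last basis vector the deficit is negative outside a
compact cube and bounded on it, so a large multiple suffices. -/
theorem exists_mem_strictCap : ∃ v ∈ strictCap, v (Fin.last 9) = 1 := by
  set e : Fin 10 → ℝ := Pi.single (Fin.last 9) 1 with he
  have he9 : e (Fin.last 9) = 1 := by simp [he]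
  obtain ⟨M, hM⟩ := exists_bound_penalty_lt 1 zero_le_one
  have he1 : ∀ i, |e i| ≤ 1 := by
    intro i
    by_cases h : i = Fin.last 9
    · simp [h, he]
    · rw [he, Pi.single_eq_of_ne h]
      simp
  have hc : Continuous fun x : ℝ × ℝ × ℝ => thetaMk x.1 x.2.1 x.2.2 • e :=
    continuous_thetaMk_smul.comp (f := fun x => (x, e)) (by fun_prop)
  obtain ⟨B, hB⟩ := (isCompact_cube M).bddAbove_image
    (f := fun x : ℝ × ℝ × ℝ => penalty (thetaMk x.1 x.2.1 x.2.2 • e) -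
      (thetaMk x.1 x.2.1 x.2.2 • e) 0)
    ((continuous_penalty.comp hc).sub ((continuous_apply 0).comp hc)).continuousOn
  refine ⟨e + Pi.single 0 (|B| + 1), fun g => ?_, ?_⟩
  swap
  · rw [Pi.add_apply, he9, Pi.single_eq_of_ne (by decide), add_zero]
  obtain ⟨a, b, c, rfl⟩ := thetaMk.exists_eq g
  rw [smul_add, thetaMk_smul_single_zero]
  have h1 : penalty (thetaMk a b c • e + Pi.single 0 (|B| + 1)) = penalty (thetaMk a b c • e) :=
    penalty_congr fun i => by
      rw [Pi.add_apply, Pi.single_eq_of_ne (succ_castSucc_ne_zero i), add_zero]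
  rw [h1, Pi.add_apply, Pi.single_eq_same]
  have hB0 := abs_nonneg B
  by_cases h : M < |a| ∨ M < |b| ∨ M < |c|
  · have := hM a b c e he1 he9 h
    linarith
  · push Not at h
    have := hB ⟨(a, b, c), ⟨abs_le.mp h.1, abs_le.mp h.2.1, abs_le.mp h.2.2⟩, rfl⟩
    have := le_abs_self B
    simp only at *
    linarith

theorem thetaGroup_smul_mk (g : thetaGroup) {v : Fin 10 → ℝ} (hv : v ≠ 0) :
    g • (Projectivization.mk ℝ v hv : RP 9) =
      Projectivization.mk ℝ (g • v) ((smul_ne_zero_iff_ne g).mpr hv) := rfl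

theorem RP.normalize_smul (g : thetaGroup) (p : RP 9) :
    RP.normalize (g • p) = g • RP.normalize p := by
  induction p using Projectivization.ind with
  | h v hv =>
    rw [thetaGroup_smul_mk, RP.normalize_mk, RP.normalize_mk, smul_last, smul_comm g]

/-- The strictly convex domain preserved by the group `G`. -/
def thetaDomain : SubMulAction thetaGroup (RP 9) where
  carrier := {p | RP.normalize p (Fin.last 9) = 1 ∧ RP.normalize p ∈ strictCap}
  smul_mem' g p hp := by
    refine ⟨?_, ?_⟩
    · rw [RP.normalize_smul, smul_last]
      exact hp.1
    · rw [RP.normalize_smul]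
      exact smul_mem_strictCap hp.2 g

namespace thetaDomain

theorem mem_iff {p : RP 9} :
    p ∈ thetaDomain ↔ RP.normalize p (Fin.last 9) = 1 ∧ RP.normalize p ∈ strictCap := Iff.rfl

theorem nonempty : (thetaDomain : Set (RP 9)).Nonempty := by
  obtain ⟨v, hv, h9⟩ := exists_mem_strictCap
  have h0 : v ≠ 0 := fun h => by simp [h] at h9
  refine ⟨Projectivization.mk ℝ v h0, ?_⟩
  rw [SetLike.mem_coe, mem_iff, RP.normalize_mk_of_last h0 h9]
  exact ⟨h9, hv⟩

theorem isOpen : IsOpen (thetaDomain : Set (RP 9)) :=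
  RP.isOpen_setOf_normalize fun _ hv _ => strictCap_mem_nhds hv

/-- The homogeneous form of the inequality between the coordinates of a point above the graph of
the penalty function. -/
theorem abs_rpow_le_of_normalized {w : Fin 10 → ℝ} (h9 : w (Fin.last 9) ≠ 0)
    (hw : (w (Fin.last 9))⁻¹ • w ∈ weakCap) (i : Fin 8) :
    |w i.succ.castSucc| ^ (5 / 4 : ℝ) ≤ |w 0| * |w (Fin.last 9)| ^ (1 / 4 : ℝ) := by
  set t := w (Fin.last 9) with ht
  have ht0 : 0 < |t| := abs_pos.mpr h9
  have h1 : |t⁻¹ * w i.succ.castSucc| ^ (5 / 4 : ℝ) ≤ t⁻¹ * w 0 := by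
    have := hw 1
    rw [one_smul] at this
    exact (abs_rpow_le_penalty (t⁻¹ • w) i).trans this
  have h2 : t⁻¹ * w 0 ≤ |t|⁻¹ * |w 0| := by
    rw [← abs_inv, ← abs_mul]
    exact le_abs_self _
  have h3 : |w i.succ.castSucc| = |t| * |t⁻¹ * w i.succ.castSucc| := by
    rw [← abs_mul, mul_inv_cancel_left₀ h9]
  calc |w i.succ.castSucc| ^ (5 / 4 : ℝ)
      = |t| ^ (5 / 4 : ℝ) * |t⁻¹ * w i.succ.castSucc| ^ (5 / 4 : ℝ) := by
        rw [h3, Real.mul_rpow (abs_nonneg _) (abs_nonneg _)]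
    _ ≤ |t| ^ (5 / 4 : ℝ) * (|t|⁻¹ * |w 0|) := by
        gcongr
        exact h1.trans h2
    _ = |w 0| * |t| ^ (1 / 4 : ℝ) := by
        rw [show (5 / 4 : ℝ) = 1 + 1 / 4 by norm_num, Real.rpow_add ht0, Real.rpow_one]
        field_simp

/-- Points in the closure of the domain are either above the graph of the penalty function, or the
single point `[1 : 0 : ⋯ : 0]` at infinity. -/
theorem mk_mem_closure {v : Fin 10 → ℝ} (hv : v ≠ 0)
    (h : Projectivization.mk ℝ v hv ∈ closure (thetaDomain : Set (RP 9))) :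
    (v (Fin.last 9) ≠ 0 ∧ (v (Fin.last 9))⁻¹ • v ∈ weakCap) ∨ ∀ i : Fin 9, v i.succ = 0 := by
  set S : Set {v : Fin 10 → ℝ // v ≠ 0} := {w | w.1 (Fin.last 9) ≠ 0 ∧
    (w.1 (Fin.last 9))⁻¹ • w.1 ∈ weakCap} with hS
  have hlast : Continuous fun w : {v : Fin 10 → ℝ // v ≠ 0} => w.1 (Fin.last 9) :=
    (continuous_apply _).comp continuous_subtype_val
  have hcl : (⟨v, hv⟩ : {v : Fin 10 → ℝ // v ≠ 0}) ∈ closure S := by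
    refine closure_mono ?_ (RP.isOpenMap_mk.preimage_closure_subset_closure_preimage h)
    intro w hw
    rw [Set.mem_preimage, SetLike.mem_coe, mem_iff, RP.normalize_mk] at hw
    exact ⟨RP.last_ne_zero_of_inv_smul hw.1, strictCap_subset_weakCap hw.2⟩
  by_cases h9 : v (Fin.last 9) = 0
  · right
    -- The homogeneous inequality survives limits, and its right side vanishes at infinity because
    -- |last coordinate|^(1/4) does; this kills the middle coordinates.
    have hclosed : IsClosed {w : {v : Fin 10 → ℝ // v ≠ 0} | ∀ i : Fin 8,
        |w.1 i.succ.castSucc| ^ (5 / 4 : ℝ) ≤ |w.1 0| * |w.1 (Fin.last 9)| ^ (1 / 4 : ℝ)} := by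
      rw [Set.ofPred_forall]
      refine isClosed_iInter fun i => ?_
      refine isClosed_le ?_ ?_
      · exact ((continuous_apply _).comp continuous_subtype_val).abs.rpow_const
          fun _ => Or.inr (by norm_num)
      · exact ((continuous_apply _).comp continuous_subtype_val).abs.mul
          (hlast.abs.rpow_const fun _ => Or.inr (by norm_num))
    have hmem := hclosed.closure_subset_iff.mpr
      (fun w (hw : w ∈ S) i => abs_rpow_le_of_normalized hw.1 hw.2 i) hcl
    intro i
    refine Fin.lastCases h9 (fun i => ?_) i
    have h1 := hmem i
    simp only [h9, abs_zero] at h1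
    rw [Real.zero_rpow (by norm_num), mul_zero] at h1
    by_contra hne
    exact absurd h1 (not_le.mpr (Real.rpow_pos_of_pos (abs_pos.mpr hne) _))
  · left
    refine ⟨h9, fun g => ?_⟩
    have hc : ContinuousAt (fun w : {v : Fin 10 → ℝ // v ≠ 0} =>
        g • ((w.1 (Fin.last 9))⁻¹ • w.1)) ⟨v, hv⟩ :=
      (continuous_smul_thetaGroup g).continuousAt.comp
        ((hlast.continuousAt.inv₀ h9).smul continuous_subtype_val.continuousAt)
    by_contra! hlt
    have hev := ((continuous_apply 0).continuousAt.comp hc).eventually_lt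
      (continuous_penalty.continuousAt.comp hc) hlt
    obtain ⟨w, hw, hw'⟩ := ((mem_closure_iff_frequently.mp hcl).and_eventually hev).exists
    exact (hw.2 g).not_gt hw'

theorem isProperlyConvex : IsProperlyConvex (thetaDomain : Set (RP 9)) := by
  -- The last coordinate alone would vanish at [1 : 0 : ⋯ : 0], which the closure may contain. At
  -- finite points of the closure the first coordinate divided by the last is non-negative, so the
  -- sum of the two does not vanish.
  let φ : Module.Dual ℝ (Fin 10 → ℝ) :=
    LinearMap.proj (R := ℝ) (φ := fun _ : Fin 10 => ℝ) (Fin.last 9) + LinearMap.proj 0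
  have hφ : ∀ u, φ u = u (Fin.last 9) + u 0 := fun _ => rfl
  refine ⟨φ, fun p hp => ?_, ?_⟩
  · have h : Projectivization.mk ℝ p.rep p.rep_nonzero ∈ closure (thetaDomain : Set (RP 9)) := by
      rwa [p.mk_rep]
    rw [hφ]
    rcases mk_mem_closure _ h with ⟨h9, hw⟩ | h0
    · have h1 := hw 1
      rw [one_smul] at h1
      have h2 := (penalty_nonneg _).trans h1
      simp only [Pi.smul_apply, smul_eq_mul] at h2
      intro h3
      have h4 : p.rep 0 = - p.rep (Fin.last 9) := by linarith
      rw [h4, mul_neg, inv_mul_cancel₀ h9] at h2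
      linarith
    · have h9 : p.rep (Fin.last 9) = 0 := h0 (Fin.last 8)
      rw [h9, zero_add]
      intro h00
      exact p.rep_nonzero (funext fun i => Fin.cases h00 h0 i)
  · have hpos : ∀ u : Fin 10 → ℝ, φ u = 1 →
        ∀ h : u ≠ 0, Projectivization.mk ℝ u h ∈ thetaDomain →
        0 < u (Fin.last 9) ∧ (u (Fin.last 9))⁻¹ • u ∈ strictCap := by
      intro u hu h0 hmem
      rw [mem_iff, RP.normalize_mk] at hmem
      refine ⟨?_, hmem.2⟩
      have h9 : u (Fin.last 9) ≠ 0 := RP.last_ne_zero_of_inv_smul hmem.1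
      have h1 := hmem.2 1
      rw [one_smul] at h1
      have h2 := (penalty_nonneg _).trans_lt h1
      simp only [Pi.smul_apply, smul_eq_mul] at h2
      rw [hφ] at hu
      have h3 : u 0 = 1 - u (Fin.last 9) := by linarith
      rw [h3, mul_sub, mul_one, inv_mul_cancel₀ h9] at h2
      exact inv_pos.mp (by linarith)
    rintro u ⟨hu, hu0, hmu⟩ v ⟨hv, hv0, hmv⟩ a b ha hb hab
    obtain ⟨hut, hus⟩ := hpos u hu hu0 hmu
    obtain ⟨hvt, hvs⟩ := hpos v hv hv0 hmv
    have hlin : φ (a • u + b • v) = 1 := by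
      rw [map_add, map_smul, map_smul, hu, hv, smul_eq_mul, smul_eq_mul, mul_one, mul_one, hab]
    have hne : a • u + b • v ≠ 0 := fun h => by rw [h, map_zero] at hlin; norm_num at hlin
    refine ⟨hlin, hne, ?_⟩
    set s := u (Fin.last 9)
    set t := v (Fin.last 9)
    have hst : (a • u + b • v) (Fin.last 9) = a * s + b * t := rfl
    have hst0 : 0 < a * s + b * t := by
      rcases ha.eq_or_lt with rfl | ha
      · obtain rfl : b = 1 := by linarith
        linarith
      · have := mul_pos ha hut
        have := mul_nonneg hb hvt.le
        linarith
    rw [SetLike.mem_coe, mem_iff, RP.normalize_mk]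
    refine ⟨?_, ?_⟩
    · rw [Pi.smul_apply, hst, smul_eq_mul, inv_mul_cancel₀ hst0.ne']
    · rw [hst]
      -- Passing from the patch φ = 1 to the patch where the last coordinate is 1 reweights the
      -- convex combination by the last coordinates, which are positive.
      have key := convex_strictCap hus hvs (a := a * s / (a * s + b * t))
        (b := b * t / (a * s + b * t)) (by positivity) (by positivity)
        (by rw [← add_div, div_self hst0.ne'])
      convert key using 1
      ext i
      simp only [Pi.smul_apply, Pi.add_apply, smul_eq_mul]
      field_simp

/-- A segment with a finite endpoint contains a second finite point near it. In the affine patch the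
midpoint of the two lies in the open domain, hence not on its frontier. -/
theorem not_projSegment_subset {u v : Fin 10 → ℝ} (huv : LinearIndependent ℝ ![u, v])
    (hu9 : u (Fin.last 9) ≠ 0) : ¬ projSegment u v ⊆ frontier (thetaDomain : Set (RP 9)) := by
  intro hsub
  rw [LinearIndependent.pair_iff] at huv
  have hcl : ∀ s t : ℝ, 0 ≤ s → 0 ≤ t → (s • u + t • v) (Fin.last 9) ≠ 0 →
      ((s • u + t • v) (Fin.last 9))⁻¹ • (s • u + t • v) ∈ weakCap := by
    intro s t hs ht h9
    have hne : s • u + t • v ≠ 0 := fun h => h9 (by rw [h]; rfl)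
    rcases mk_mem_closure hne (frontier_subset_closure (hsub ⟨s, t, hs, ht, hne, rfl⟩)) with h | h
    · exact h.2
    · exact absurd (h (Fin.last 8)) h9
  set s := u (Fin.last 9) with hs
  -- Then |ε v₉| = |s| - ε < |s|, so u + εv has a last coordinate of the same sign as that of u.
  set ε : ℝ := |s| / (|v (Fin.last 9)| + 1) with hε
  have hε0 : 0 < ε := by positivity
  set t := s + ε * v (Fin.last 9) with ht
  have hst : 0 < s * t := by
    have h1 : ε * (|v (Fin.last 9)| + 1) = |s| := by rw [hε]; field_simp
    have h2 : |s * (ε * v (Fin.last 9))| = |s| * (|s| - ε) := by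
      rw [abs_mul, abs_mul, abs_of_pos hε0, ← h1]
      ring
    have h3 := neg_abs_le (s * (ε * v (Fin.last 9)))
    have h4 : 0 < |s| * ε := by positivity
    have h5 : |s| * |s| = s * s := abs_mul_abs_self s
    rw [ht, mul_add]
    linarith
  have ht0 : t ≠ 0 := right_ne_zero_of_mul hst.ne'
  have e1 : ((1 : ℝ) • u + (0 : ℝ) • v) = u := by simp
  have e2 : (1 : ℝ) • u + ε • v = u + ε • v := by simp
  have e3 : (u + ε • v) (Fin.last 9) = t := rfl
  have hU := hcl 1 0 zero_le_one le_rfl (by rwa [e1])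
  have hW := hcl 1 ε zero_le_one hε0.le (by rwa [e2, e3])
  rw [e1, ← hs] at hU
  rw [e2, e3] at hW
  have hne : s⁻¹ • u ≠ t⁻¹ • (u + ε • v) := by
    intro h
    have h' : (s⁻¹ - t⁻¹) • u + (-(t⁻¹ * ε)) • v = 0 := by
      rw [sub_smul, h]
      module
    have := (huv _ _ h').2
    simp [ht0, hε0.ne'] at this
  have hZ := combo_mem_strictCap hne (by
    rw [Pi.smul_apply, Pi.smul_apply, e3, ← hs, smul_eq_mul, smul_eq_mul, inv_mul_cancel₀ hu9,
      inv_mul_cancel₀ ht0]) hU hW (a := 1 / 2)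
    (b := 1 / 2) (by norm_num) (by norm_num) (by norm_num)
  have hst' : 0 < s / t := by
    rw [show s / t = s * t / t ^ 2 by field_simp]
    positivity
  -- The affine midpoint, rescaled by s, has non-negative coefficients in u and v because s/t > 0,
  -- so it lies on the given projective segment.
  have hcomb : (1 / 2 + s / t / 2) • u + (s / t * ε / 2) • v =
      s • ((1 / 2 : ℝ) • s⁻¹ • u + (1 / 2 : ℝ) • t⁻¹ • (u + ε • v)) := by
    ext i
    simp only [Pi.smul_apply, Pi.add_apply, smul_eq_mul]
    field_simp
    ring
  have hlast : ((1 / 2 + s / t / 2) • u + (s / t * ε / 2) • v) (Fin.last 9) = s := by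
    rw [hcomb]
    simp only [Pi.smul_apply, Pi.add_apply, smul_eq_mul, ← hs]
    rw [show s + ε * v (Fin.last 9) = t from rfl]
    field_simp
    norm_num
  have hne0 : (1 / 2 + s / t / 2) • u + (s / t * ε / 2) • v ≠ 0 := fun h => hu9 (by
    rw [← hlast, h]; rfl)
  have hfr := hsub ⟨1 / 2 + s / t / 2, s / t * ε / 2, by positivity, by positivity, hne0, rfl⟩
  rw [isOpen.frontier_eq] at hfr
  refine hfr.2 ?_
  rw [SetLike.mem_coe, mem_iff, RP.normalize_mk, hlast, hcomb, inv_smul_smul₀ hu9]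
  refine ⟨?_, hZ⟩
  simp only [Pi.smul_apply, Pi.add_apply, smul_eq_mul, ← hs]
  rw [show s + ε * v (Fin.last 9) = t from rfl, inv_mul_cancel₀ hu9, inv_mul_cancel₀ ht0]
  norm_num

theorem isStrictlyConvexDomain : IsStrictlyConvexDomain (thetaDomain : Set (RP 9)) where
  nonempty := nonempty
  isOpen := isOpen
  properlyConvex := isProperlyConvex
  no_segment u v huv hsub := by
    by_cases hu9 : u (Fin.last 9) = 0
    · by_cases hv9 : v (Fin.last 9) = 0
      -- Both endpoints are at infinity, hence both equal [1 : 0 : ⋯ : 0], against independence.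
      · have hu0 : u ≠ 0 := huv.ne_zero 0
        have hv0 : v ≠ 0 := huv.ne_zero 1
        have hu : ∀ i : Fin 9, u i.succ = 0 := by
          have hmem : Projectivization.mk ℝ u hu0 ∈ projSegment u v :=
            ⟨1, 0, zero_le_one, le_rfl, by simpa using hu0, by simp⟩
          rcases mk_mem_closure hu0 (frontier_subset_closure (hsub hmem)) with h | h
          · exact absurd hu9 h.1
          · exact h
        have hv : ∀ i : Fin 9, v i.succ = 0 := by
          have hmem : Projectivization.mk ℝ v hv0 ∈ projSegment u v :=
            ⟨0, 1, le_rfl, zero_le_one, by simpa using hv0, by simp⟩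
          rcases mk_mem_closure hv0 (frontier_subset_closure (hsub hmem)) with h | h
          · exact absurd hv9 h.1
          · exact h
        rw [LinearIndependent.pair_iff] at huv
        have h := huv (v 0) (-u 0) (by
          ext i
          refine Fin.cases ?_ (fun i => ?_) i
          · simp; ring
          · simp [hu i, hv i])
        exact hv0 (funext fun i => Fin.cases h.1 hv i)
      · refine not_projSegment_subset (LinearIndependent.pair_symm_iff.mp huv) hv9 ?_
        rintro _ ⟨s, t, hs, ht, h, rfl⟩
        have e : s • v + t • u = t • u + s • v := add_comm _ _
        exact hsub ⟨t, s, ht, hs, e ▸ h, by simp only [e]⟩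
    · exact not_projSegment_subset huv hu9 hsub

/-! ### The topology of the domain -/

/-- The coordinates of a point of the domain in the affine patch. -/
def chart (q : thetaDomain) : EuclideanSpace ℝ (Fin 9) :=
  WithLp.toLp 2 fun i => RP.normalize (q : RP 9) i.castSucc

theorem affinePoint_chart (q : thetaDomain) : affinePoint (chart q) = (q : RP 9) :=
  RP.affinePoint_init q.2.1

theorem isOpenEmbedding_chart : Topology.IsOpenEmbedding chart := by
  refine Topology.IsOpenEmbedding.of_comp chart RP.isOpenEmbedding_affinePoint ?_
  have : affinePoint ∘ chart = ((↑) : thetaDomain → RP 9) := funext affinePoint_chart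
  rw [this]
  exact isOpen.isOpenEmbedding_subtypeVal

theorem range_chart : Set.range chart = {x : EuclideanSpace ℝ (Fin 9) |
    (Fin.snoc (α := fun _ => ℝ) (fun i => x i) 1 : Fin 10 → ℝ) ∈ strictCap} := by
  ext x
  constructor
  · rintro ⟨q, rfl⟩
    have := q.2.2
    rw [← affinePoint_chart, RP.normalize_affinePoint] at this
    exact this
  · intro hx
    refine ⟨⟨affinePoint x, ?_, ?_⟩, ?_⟩
    · rw [RP.normalize_affinePoint, Fin.snoc_last]
    · rw [RP.normalize_affinePoint]
      exact hx
    · apply RP.affinePoint_injective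
      rw [affinePoint_chart]

theorem convex_range_chart : Convex ℝ (Set.range chart) := by
  rw [range_chart]
  intro x hx y hy a b ha hb hab
  have := convex_strictCap hx hy ha hb hab
  rw [Set.mem_ofPred_eq]
  convert this using 1
  ext i
  refine Fin.lastCases ?_ (fun i => ?_) i
  · rw [Pi.add_apply, Pi.smul_apply, Pi.smul_apply, Fin.snoc_last, Fin.snoc_last, Fin.snoc_last,
      smul_eq_mul, smul_eq_mul, mul_one, mul_one, hab]
  · rw [Pi.add_apply, Pi.smul_apply, Pi.smul_apply, Fin.snoc_castSucc, Fin.snoc_castSucc,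
      Fin.snoc_castSucc]
    simp

instance : Nonempty thetaDomain := nonempty.to_subtype

instance : T2Space thetaDomain := isOpenEmbedding_chart.isEmbedding.t2Space

instance : LocallyCompactSpace thetaDomain := isOpenEmbedding_chart.locallyCompactSpace

instance : SecondCountableTopology thetaDomain :=
  isOpenEmbedding_chart.isEmbedding.secondCountableTopology

instance : ContractibleSpace thetaDomain := by
  have : ContractibleSpace (Set.range chart) :=
    convex_range_chart.contractibleSpace (Set.range_nonempty chart)
  exact isOpenEmbedding_chart.isEmbedding.toHomeomorph.contractibleSpace

/-! ### The action of the integral lattice -/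

theorem coe_smul (γ : integralTheta) (q : thetaDomain) :
    ((γ • q : thetaDomain) : RP 9) = (γ : thetaGroup) • (q : RP 9) := rfl

instance : ContinuousConstSMul integralTheta thetaDomain where
  continuous_const_smul γ := by
    refine Continuous.subtype_mk ?_ _
    exact (RP.continuous_smul_of_linear ((γ : thetaGroup) : SL(10, ℝ))).comp
      continuous_subtype_val

/-- A coordinate of the normalized representative of a point of the domain. -/
def coord (i : Fin 10) (q : thetaDomain) : ℝ := RP.normalize (q : RP 9) i

theorem continuous_coord (i : Fin 10) : Continuous (coord i) :=
  (continuous_apply i).comp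
    (RP.continuousOn_normalize.comp_continuous continuous_subtype_val fun q => q.2.1)

theorem normalize_mk_smul (i j k : ℤ) (q : thetaDomain) :
    RP.normalize (integralTheta.mk i j k • q : thetaDomain).1 =
      (thetaMatrix i j k).mulVec (RP.normalize (q : RP 9)) := by
  rw [← thetaMk_smul, ← RP.normalize_smul]
  rfl

theorem coord_last (q : thetaDomain) : RP.normalize (q : RP 9) 9 = 1 := q.2.1

/-- The coordinates 5, 8 and 2 transform exactly as a, b and c do under left multiplication in the
Heisenberg group. Freeness and proper discontinuity are read off from them. -/
theorem coord_five_smul (i j k : ℤ) (q : thetaDomain) :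
    coord 5 (integralTheta.mk i j k • q) = coord 5 q + i := by
  rw [coord, normalize_mk_smul]
  simp [thetaMatrix, Matrix.mulVec, dotProduct, Fin.sum_univ_succ, coord, coord_last]

theorem coord_eight_smul (i j k : ℤ) (q : thetaDomain) :
    coord 8 (integralTheta.mk i j k • q) = coord 8 q + j := by
  rw [coord, normalize_mk_smul]
  simp [thetaMatrix, Matrix.mulVec, dotProduct, Fin.sum_univ_succ, coord, coord_last]

theorem coord_two_smul (i j k : ℤ) (q : thetaDomain) :
    coord 2 (integralTheta.mk i j k • q) = coord 2 q + i * coord 8 q + k := by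
  rw [coord, normalize_mk_smul]
  simp [thetaMatrix, Matrix.mulVec, dotProduct, Fin.sum_univ_succ, coord, coord_last, add_assoc]

theorem eq_one_of_smul_eq (γ : integralTheta) (q : thetaDomain) (h : γ • q = q) : γ = 1 := by
  obtain ⟨i, j, k, rfl⟩ := integralTheta.exists_eq γ
  have h5 := coord_five_smul i j k q
  have h8 := coord_eight_smul i j k q
  have h2 := coord_two_smul i j k q
  rw [h] at h5 h8 h2
  have hi : (i : ℝ) = 0 := by linarith
  have hj : (j : ℝ) = 0 := by linarith
  have hk : (k : ℝ) = 0 := by rw [hi] at h2; linarith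
  rw [Int.cast_eq_zero] at hi hj hk
  rw [hi, hj, hk, integralTheta.mk_zero]

instance : IsCancelSMul integralTheta thetaDomain :=
  isCancelSMul_iff_eq_one_of_smul_eq.mpr eq_one_of_smul_eq

theorem exists_abs_coord_le {K : Set thetaDomain} (hK : IsCompact K) (i : Fin 10) :
    ∃ B, ∀ q ∈ K, |coord i q| ≤ B :=
  hK.exists_bound_of_continuousOn (continuous_coord i).continuousOn

instance : ProperlyDiscontinuousSMul integralTheta thetaDomain where
  finite_disjoint_inter_image := by
    intro K L hK hL
    have hKL := hK.union hL
    obtain ⟨B5, h5⟩ := exists_abs_coord_le hKL 5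
    obtain ⟨B8, h8⟩ := exists_abs_coord_le hKL 8
    obtain ⟨B2, h2⟩ := exists_abs_coord_le hKL 2
    have hfin : ∀ B : ℝ, {i : ℤ | |(i : ℝ)| ≤ B}.Finite := by
      intro B
      refine (Set.finite_Icc (-⌈B⌉) ⌈B⌉).subset fun i hi => ?_
      have h1 := abs_le.mp (show |(i : ℝ)| ≤ B from hi)
      have h2 := Int.le_ceil B
      constructor
      · have : ((-⌈B⌉ : ℤ) : ℝ) ≤ i := by push_cast; linarith
        exact_mod_cast this
      · have : (i : ℝ) ≤ (⌈B⌉ : ℤ) := by linarith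
        exact_mod_cast this
    -- The extra term 2·B5·B8 bounds the shear term `i * coord 8 q` in the transformation of
    -- coordinate 2.
    refine (((hfin (2 * B5)).prod ((hfin (2 * B8)).prod (hfin (2 * B2 + 2 * B5 * B8)))).image
      fun x => integralTheta.mk x.1 x.2.1 x.2.2).subset ?_
    intro γ hγ
    obtain ⟨_, ⟨q, hq, rfl⟩, hq'⟩ := hγ
    obtain ⟨i, j, k, rfl⟩ := integralTheta.exists_eq γ
    refine ⟨(i, j, k), ?_, rfl⟩
    have a5 := abs_le.mp (h5 q (Or.inl hq))
    have a5' := abs_le.mp (h5 _ (Or.inr hq'))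
    have a8 := abs_le.mp (h8 q (Or.inl hq))
    have a8' := abs_le.mp (h8 _ (Or.inr hq'))
    have a2 := abs_le.mp (h2 q (Or.inl hq))
    have a2' := abs_le.mp (h2 _ (Or.inr hq'))
    simp only [coord_five_smul, coord_eight_smul, coord_two_smul] at a5' a8' a2'
    have hi : |(i : ℝ)| ≤ 2 * B5 := abs_le.mpr ⟨by linarith, by linarith⟩
    have hj : |(j : ℝ)| ≤ 2 * B8 := abs_le.mpr ⟨by linarith, by linarith⟩
    have hib : |(i : ℝ) * coord 8 q| ≤ 2 * B5 * B8 := by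
      rw [abs_mul]
      exact mul_le_mul hi (h8 q (Or.inl hq)) (abs_nonneg _) ((abs_nonneg _).trans hi)
    have hib' := abs_le.mp hib
    have hk : |(k : ℝ)| ≤ 2 * B2 + 2 * B5 * B8 := abs_le.mpr ⟨by linarith, by linarith⟩
    exact ⟨hi, hj, hk⟩

/-- The quotient map of the domain by the integral lattice. -/
def proj : thetaDomain → MulAction.orbitRel.Quotient integralTheta thetaDomain :=
  Quotient.mk _

theorem isQuotientCoveringMap_proj : IsQuotientCoveringMap proj integralTheta :=
  isQuotientCoveringMap_quotientMk_of_properlyDiscontinuousSMul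

theorem nonempty_fundamentalGroup_mulEquiv
    (x : MulAction.orbitRel.Quotient integralTheta thetaDomain) :
    Nonempty (FundamentalGroup _ x ≃* integralTheta) := by
  obtain ⟨q, hq⟩ := isQuotientCoveringMap_proj.surjective x
  -- Monodromy gives the opposite group of Γ; inversion identifies it with Γ.
  exact ⟨(isQuotientCoveringMap_proj.fundamentalGroupEquiv ⟨q, hq⟩).trans
    (MulEquiv.inv' integralTheta).symm⟩

/-! ### The projective structure on the quotient -/

/-- A local inverse of the quotient map near the image of a point. -/
def localSection (x : MulAction.orbitRel.Quotient integralTheta thetaDomain) :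
    OpenPartialHomeomorph thetaDomain (MulAction.orbitRel.Quotient integralTheta thetaDomain) :=
  (isQuotientCoveringMap_proj.isCoveringMap.isLocalHomeomorph
    (isQuotientCoveringMap_proj.surjective x).choose).choose

theorem coe_localSection (x : MulAction.orbitRel.Quotient integralTheta thetaDomain) :
    ⇑(localSection x) = proj :=
  (isQuotientCoveringMap_proj.isCoveringMap.isLocalHomeomorph
    (isQuotientCoveringMap_proj.surjective x).choose).choose_spec.2.symm

theorem mem_localSection_target (x : MulAction.orbitRel.Quotient integralTheta thetaDomain) :
    x ∈ (localSection x).target := by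
  have h1 := (isQuotientCoveringMap_proj.isCoveringMap.isLocalHomeomorph
    (isQuotientCoveringMap_proj.surjective x).choose).choose_spec.1
  have h2 := (localSection x).map_source h1
  rwa [coe_localSection, (isQuotientCoveringMap_proj.surjective x).choose_spec] at h2

/-- The affine chart of the domain as a partial homeomorphism. -/
def chartHomeomorph : OpenPartialHomeomorph thetaDomain (EuclideanSpace ℝ (Fin 9)) :=
  isOpenEmbedding_chart.toOpenPartialHomeomorph chart

/-- The charts of the quotient manifold. -/
def quotientChart (x : MulAction.orbitRel.Quotient integralTheta thetaDomain) :
    OpenPartialHomeomorph (MulAction.orbitRel.Quotient integralTheta thetaDomain)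
      (EuclideanSpace ℝ (Fin 9)) :=
  (localSection x).symm.trans chartHomeomorph

theorem affinePoint_chartHomeomorph (q : thetaDomain) :
    affinePoint (chartHomeomorph q) = (q : RP 9) := affinePoint_chart q

theorem proj_smul (γ : integralTheta) (q : thetaDomain) : proj (γ • q) = proj q :=
  isQuotientCoveringMap_proj.map_smul γ

/-- The linear automorphism given by an element of the integral lattice. -/
def linearEquiv (γ : integralTheta) : (Fin 10 → ℝ) ≃ₗ[ℝ] (Fin 10 → ℝ) :=
  DistribMulAction.toLinearEquiv ℝ (Fin 10 → ℝ) ((γ : thetaGroup) : SL(10, ℝ))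

theorem linearEquiv_smul (γ : integralTheta) (p : RP 9) :
    linearEquiv γ • p = (γ : thetaGroup) • p := by
  induction p using Projectivization.ind with
  | h v hv => rfl

/-- Near p, the local section composed with the projection is a single deck transformation γ, which
is a projective map. This yields both the transition maps and the compatibility of the charts with
the projection. -/
theorem eventually_affinePoint_quotientChart
    (x : MulAction.orbitRel.Quotient integralTheta thetaDomain) (p : thetaDomain)
    (hp : proj p ∈ (quotientChart x).source) :
    ∃ γ : integralTheta, ∀ᶠ q in 𝓝 p,
      affinePoint (quotientChart x (proj q)) = linearEquiv γ • (q : RP 9) := by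
  have hpt : proj p ∈ (localSection x).target := by
    rw [quotientChart, OpenPartialHomeomorph.trans_source] at hp
    exact hp.1
  have h1 : proj ((localSection x).symm (proj p)) = proj p := by
    have := (localSection x).right_inv hpt
    rwa [coe_localSection] at this
  obtain ⟨γ, hγ⟩ := isQuotientCoveringMap_proj.apply_eq_iff_mem_orbit.mp h1
  have hγ' : γ • p = (localSection x).symm (proj p) := hγ
  refine ⟨γ, ?_⟩
  have hsrc : γ • p ∈ (localSection x).source := hγ' ▸ (localSection x).map_target hpt
  have hev : ∀ᶠ q in 𝓝 p, γ • q ∈ (localSection x).source :=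
    (continuous_const_smul γ).continuousAt.eventually
      ((localSection x).open_source.mem_nhds hsrc)
  filter_upwards [hev] with q hq
  have h2 : (localSection x).symm (proj q) = γ • q := by
    have := (localSection x).left_inv hq
    rwa [coe_localSection, proj_smul] at this
  rw [quotientChart, OpenPartialHomeomorph.coe_trans, Function.comp_apply,
    affinePoint_chartHomeomorph, h2, linearEquiv_smul, coe_smul]

theorem isProjectiveManifoldVia :
    IsProjectiveManifoldVia (n := 9) (U := (thetaDomain : Set (RP 9)))
      (fun p => (Quotient.mk _ p : MulAction.orbitRel.Quotient integralTheta thetaDomain)) := by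
  refine ⟨inferInstance, ?_, ?_⟩
  · exact ContinuousConstSMul.secondCountableTopology
  let cs : ChartedSpace (EuclideanSpace ℝ (Fin 9))
      (MulAction.orbitRel.Quotient integralTheta thetaDomain) :=
    { atlas := Set.range quotientChart
      chartAt := quotientChart
      mem_chart_source := fun x => by
        rw [quotientChart, OpenPartialHomeomorph.trans_source]
        exact ⟨mem_localSection_target x, Set.mem_univ _⟩
      chart_mem_atlas := fun x => ⟨x, rfl⟩ }
  refine ⟨cs, ⟨?_⟩, ?_⟩
  · rintro _ _ ⟨x, rfl⟩ ⟨y, rfl⟩ z hz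
    rw [OpenPartialHomeomorph.trans_source] at hz
    have hsymm : ∀ w, (quotientChart x).symm w = proj (chartHomeomorph.symm w) := by
      intro w
      rw [quotientChart, OpenPartialHomeomorph.coe_trans_symm, Function.comp_apply,
        OpenPartialHomeomorph.symm_symm, coe_localSection]
    have hzt : z ∈ chartHomeomorph.target := by
      have := hz.1
      rw [OpenPartialHomeomorph.symm_source, quotientChart,
        OpenPartialHomeomorph.trans_target] at this
      exact this.1
    have hzy : proj (chartHomeomorph.symm z) ∈ (quotientChart y).source := by
      rw [← hsymm]
      exact hz.2
    obtain ⟨γ, hγ⟩ := eventually_affinePoint_quotientChart y _ hzy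
    refine ⟨linearEquiv γ, ?_⟩
    filter_upwards [(chartHomeomorph.symm.continuousAt hzt).eventually hγ,
      chartHomeomorph.open_target.mem_nhds hzt] with w hw hwt
    rw [OpenPartialHomeomorph.coe_trans, Function.comp_apply, hsymm, hw,
      ← affinePoint_chartHomeomorph, chartHomeomorph.right_inv hwt]
  · rintro _ ⟨x, rfl⟩ p hp
    obtain ⟨γ, hγ⟩ := eventually_affinePoint_quotientChart x p hp
    exact ⟨linearEquiv γ, hγ⟩

end thetaDomain

/-! ### The integral subgroup is a lattice -/

/-- The coordinates `(a, b, c)` identify the group `G` with `ℝ³`. -/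
def thetaHomeomorph : ℝ × ℝ × ℝ ≃ₜ thetaGroup where
  toFun x := thetaMk x.1 x.2.1 x.2.2
  invFun g := ((g : SL(10, ℝ)).1 2 8, (g : SL(10, ℝ)).1 1 2, (g : SL(10, ℝ)).1 2 9)
  left_inv _ := rfl
  right_inv g := by
    obtain ⟨a, b, c, rfl⟩ := thetaMk.exists_eq g
    rfl
  continuous_toFun := Continuous.subtype_mk (Continuous.subtype_mk continuous_thetaMatrix _) _
  continuous_invFun := by
    have h : ∀ i j : Fin 10, Continuous fun g : thetaGroup => (g : SL(10, ℝ)).1 i j := fun i j =>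
      (continuous_apply_apply i j).comp
        (Matrix.SpecialLinearGroup.isClosedEmbedding_val.continuous.comp continuous_subtype_val)
    exact (h 2 8).prodMk ((h 1 2).prodMk (h 2 9))

theorem thetaHomeomorph_apply (x : ℝ × ℝ × ℝ) :
    thetaHomeomorph x = thetaMk x.1 x.2.1 x.2.2 := rfl

theorem thetaHomeomorph_symm_mk (a b c : ℝ) : thetaHomeomorph.symm (thetaMk a b c) = (a, b, c) :=
  rfl

namespace integralTheta

instance : Countable integralTheta := by
  refine Function.Surjective.countable (f := fun x : ℤ × ℤ × ℤ => mk x.1 x.2.1 x.2.2) fun γ => ?_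
  obtain ⟨i, j, k, rfl⟩ := exists_eq γ
  exact ⟨(i, j, k), rfl⟩

instance : DiscreteTopology integralTheta := by
  rw [discreteTopology_iff_isOpen_singleton]
  intro γ
  obtain ⟨i, j, k, rfl⟩ := exists_eq γ
  have hc : Continuous fun γ : integralTheta => thetaHomeomorph.symm (γ : thetaGroup) :=
    thetaHomeomorph.symm.continuous.comp continuous_subtype_val
  have : {mk i j k} = (fun γ : integralTheta => thetaHomeomorph.symm (γ : thetaGroup)) ⁻¹'
      (Metric.ball (i : ℝ) 1 ×ˢ Metric.ball (j : ℝ) 1 ×ˢ Metric.ball (k : ℝ) 1) := by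
    ext γ
    obtain ⟨i', j', k', rfl⟩ := exists_eq γ
    have key : ∀ m n : ℤ, dist (m : ℝ) n < 1 ↔ m = n := by
      intro m n
      rw [Int.dist_cast_real, Int.dist_eq, ← Int.cast_sub, ← Int.cast_abs]
      constructor
      · intro h
        have : |m - n| < 1 := by exact_mod_cast h
        rw [Int.abs_lt_one_iff] at this
        omega
      · rintro rfl
        simp
    rw [Set.mem_singleton_iff, mk_eq_iff, Set.mem_preimage]
    simp only [mk, thetaHomeomorph_symm_mk, Set.mem_prod, Metric.mem_ball, key]
  rw [this]
  exact (Metric.isOpen_ball.prod (Metric.isOpen_ball.prod Metric.isOpen_ball)).preimage hc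

end integralTheta

/-! ### Haar measure and the fundamental cube -/

open MeasureTheory
open scoped Pointwise

/-- The Borel structure of the group `G`. -/
instance thetaGroup.instMeasurableSpace : MeasurableSpace thetaGroup := borel _

instance thetaGroup.instBorelSpace : BorelSpace thetaGroup := ⟨rfl⟩

/-- The Haar measure of the group `G` given by Lebesgue measure in coordinates. -/
def thetaHaar : Measure thetaGroup := (volume : Measure (ℝ × ℝ × ℝ)).map thetaHomeomorph

namespace thetaHaar

theorem measurePreserving : MeasurePreserving thetaHomeomorph volume thetaHaar :=
  ⟨thetaHomeomorph.continuous.measurable, rfl⟩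

/-- Left multiplication is a translation composed with a shear, and is a translation on each fibre,
so Fubini applies. -/
theorem measurePreserving_left (a b c : ℝ) :
    MeasurePreserving (fun x : ℝ × ℝ × ℝ => (a + x.1, b + x.2.1, c + x.2.2 + a * x.2.1)) := by
  suffices h : MeasurePreserving (fun x : ℝ × ℝ => (b + x.1, c + x.2 + a * x.1)) volume volume from
    (measurePreserving_add_left volume a).prod h
  refine MeasurePreserving.skew_product (f := fun y => b + y)
    (g := fun y z => c + z + a * y) (measurePreserving_add_left volume b) ?_ ?_
  · exact Continuous.measurable (by unfold Function.uncurry; fun_prop)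
  · refine Filter.Eventually.of_forall fun y => ?_
    have : (fun z => c + z + a * y) = fun z => (c + a * y) + z := by ext z; ring
    rw [this]
    exact map_add_left_eq_self volume _

theorem measurePreserving_right (a b c : ℝ) :
    MeasurePreserving (fun x : ℝ × ℝ × ℝ => (x.1 + a, x.2.1 + b, x.2.2 + c + x.1 * b)) := by
  refine MeasurePreserving.skew_product (f := fun x => x + a)
    (g := fun x (y : ℝ × ℝ) => (y.1 + b, y.2 + c + x * b))
    (measurePreserving_add_right volume a) ?_ ?_
  · exact Continuous.measurable (by unfold Function.uncurry; fun_prop)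
  · refine Filter.Eventually.of_forall fun x => ?_
    have : (fun y : ℝ × ℝ => (y.1 + b, y.2 + c + x * b)) = fun y => y + (b, c + x * b) := by
      ext y
      · rfl
      · simp; ring
    rw [this]
    exact map_add_right_eq_self volume _

instance : thetaHaar.IsMulLeftInvariant where
  map_mul_left_eq_self g := by
    obtain ⟨a, b, c, rfl⟩ := thetaMk.exists_eq g
    have h := measurePreserving.comp (measurePreserving_left a b c)
    have e : thetaHomeomorph ∘ (fun x : ℝ × ℝ × ℝ => (a + x.1, b + x.2.1, c + x.2.2 + a * x.2.1)) =
        (fun y => thetaMk a b c * y) ∘ thetaHomeomorph := by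
      ext1 x
      simp only [Function.comp_apply, thetaHomeomorph_apply, thetaMk.mul]
    rw [e] at h
    rw [thetaHaar, Measure.map_map (measurable_const_mul _) thetaHomeomorph.continuous.measurable]
    exact h.map_eq

instance : thetaHaar.IsMulRightInvariant where
  map_mul_right_eq_self g := by
    obtain ⟨a, b, c, rfl⟩ := thetaMk.exists_eq g
    have h := measurePreserving.comp (measurePreserving_right a b c)
    have e : thetaHomeomorph ∘ (fun x : ℝ × ℝ × ℝ => (x.1 + a, x.2.1 + b, x.2.2 + c + x.1 * b)) =
        (fun y => y * thetaMk a b c) ∘ thetaHomeomorph := by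
      ext1 x
      simp only [Function.comp_apply, thetaHomeomorph_apply, thetaMk.mul]
    rw [e] at h
    rw [thetaHaar, Measure.map_map (measurable_mul_const _) thetaHomeomorph.continuous.measurable]
    exact h.map_eq

end thetaHaar

/-- The unit cube in coordinates. -/
def thetaCube : Set thetaGroup :=
  thetaHomeomorph.symm ⁻¹' (Set.Ico 0 1 ×ˢ Set.Ico 0 1 ×ˢ Set.Ico 0 1)

theorem measurableSet_thetaCube : MeasurableSet thetaCube :=
  thetaHomeomorph.symm.continuous.measurable
    (measurableSet_Ico.prod (measurableSet_Ico.prod measurableSet_Ico))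

theorem thetaHaar_thetaCube : thetaHaar thetaCube = 1 := by
  rw [thetaHaar, Measure.map_apply thetaHomeomorph.continuous.measurable measurableSet_thetaCube,
    thetaCube, ← Set.preimage_comp, thetaHomeomorph.symm_comp_self, Set.preimage_id,
    Measure.volume_eq_prod, Measure.prod_prod, Measure.volume_eq_prod, Measure.prod_prod]
  simp

theorem add_intCast_mem_Ico_iff (x : ℝ) (n : ℤ) : x + n ∈ Set.Ico (0 : ℝ) 1 ↔ n = -⌊x⌋ := by
  rw [eq_neg_iff_add_eq_zero, add_comm n, ← Int.floor_add_intCast, Int.floor_eq_zero_iff]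

/-- Right multiplication is used because G ⧸ Γ consists of left cosets. Bringing g into the cube
determines i and j by the floors of a and b, and then k by the floor of c + aj. -/
theorem isFundamentalDomain_thetaCube :
    IsFundamentalDomain integralTheta.op thetaCube thetaHaar := by
  refine IsFundamentalDomain.mk' measurableSet_thetaCube.nullMeasurableSet fun g => ?_
  obtain ⟨a, b, c, rfl⟩ := thetaMk.exists_eq g
  have key : ∀ i j k : ℤ, thetaMk a b c * thetaMk i j k ∈ thetaCube ↔
      i = -⌊a⌋ ∧ j = -⌊b⌋ ∧ k = -⌊c + a * j⌋ := by
    intro i j k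
    rw [thetaMk.mul, thetaCube, Set.mem_preimage, thetaHomeomorph_symm_mk, Set.mem_prod,
      Set.mem_prod, ← add_intCast_mem_Ico_iff, ← add_intCast_mem_Ico_iff,
      ← add_intCast_mem_Ico_iff, add_right_comm]
  have hmem : ∀ γ : integralTheta.op, ∃ i j k : ℤ,
      γ = ⟨MulOpposite.op (thetaMk i j k), i, j, k, rfl⟩ := by
    rintro ⟨γ, i, j, k, h⟩
    exact ⟨i, j, k, Subtype.ext (MulOpposite.unop_injective h)⟩
  refine ⟨⟨MulOpposite.op (thetaMk (-⌊a⌋ : ℤ) (-⌊b⌋ : ℤ) (-⌊c + a * (-⌊b⌋ : ℤ)⌋ : ℤ)),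
    _, _, _, rfl⟩, (key _ _ _).mpr ⟨rfl, rfl, rfl⟩, ?_⟩
  intro γ hγ
  obtain ⟨i, j, k, rfl⟩ := hmem γ
  obtain ⟨rfl, rfl, rfl⟩ := (key _ _ _).mp hγ
  rfl

theorem isLatticeIn_integralTheta : IsLatticeIn integralTheta := by
  refine ⟨inferInstance, ?_⟩
  let _ : MeasurableSpace (thetaGroup ⧸ integralTheta) := borel _
  have _ : BorelSpace (thetaGroup ⧸ integralTheta) := ⟨rfl⟩
  have hmk : Measurable (QuotientGroup.mk : thetaGroup → thetaGroup ⧸ integralTheta) :=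
    QuotientGroup.continuous_mk.measurable
  have hval : ∀ s : Set (thetaGroup ⧸ integralTheta), MeasurableSet s →
      (thetaHaar.restrict thetaCube).map QuotientGroup.mk s =
        thetaHaar (QuotientGroup.mk ⁻¹' s ∩ thetaCube) := fun s hs => by
    rw [Measure.map_apply hmk hs, Measure.restrict_apply (hmk hs)]
  have huniv : (thetaHaar.restrict thetaCube).map
      (QuotientGroup.mk : thetaGroup → thetaGroup ⧸ integralTheta) Set.univ = 1 := by
    rw [hval _ MeasurableSet.univ, Set.preimage_univ, Set.univ_inter, thetaHaar_thetaCube]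
  refine ⟨(thetaHaar.restrict thetaCube).map QuotientGroup.mk, ?_, ?_, fun g s hs => ?_⟩
  · intro h
    rw [h] at huniv
    simp at huniv
  · rw [huniv]
    exact ENNReal.one_lt_top
  · have hcont : Continuous fun x : thetaGroup ⧸ integralTheta => g • x := continuous_const_smul g
    rw [hval _ (hcont.measurable hs), hval _ hs]
    -- Left translation commutes with the right action of Γ, so the translated cube is again a
    -- fundamental domain. A right Γ-invariant set meets both in equal measure, and left invariance
    -- of Haar measure concludes.
    have hdom : IsFundamentalDomain integralTheta.op (g • thetaCube) thetaHaar :=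
      isFundamentalDomain_thetaCube.smul_of_comm g
    rw [isFundamentalDomain_thetaCube.measure_set_eq hdom (hmk hs) fun γ => ?_,
      ← measure_preimage_mul thetaHaar g (QuotientGroup.mk ⁻¹' s ∩ g • thetaCube)]
    · congr 1
      ext x
      simp [Set.mem_smul_set_iff_inv_smul_mem]
    · ext x
      have : (QuotientGroup.mk (γ • x) : thetaGroup ⧸ integralTheta) = QuotientGroup.mk x :=
        QuotientGroup.mk_mul_of_mem x γ.2
      rw [Set.mem_preimage, Set.mem_preimage, Set.mem_preimage, this]

end

theorem mainTheorem2 :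
    ∃ Ω : SubMulAction thetaGroup (RP 9), IsStrictlyConvexDomain (Ω : Set (RP 9)) ∧
      ∃ Γ : Subgroup thetaGroup,
        IsLatticeIn Γ ∧
        -- `Γ` acts freely and properly discontinuously on `Ω`
        (∀ (γ : Γ) (p : Ω), γ • p = p → γ = 1) ∧
        ProperlyDiscontinuousSMul Γ Ω ∧
        -- `Ω / Γ` is a real projective manifold of dimension `9`
        IsProjectiveManifoldVia (n := 9) (U := (Ω : Set (RP 9)))
          (fun p => (Quotient.mk _ p : MulAction.orbitRel.Quotient Γ Ω)) ∧
        -- with fundamental group `Γ`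
        (∀ x : MulAction.orbitRel.Quotient Γ Ω, Nonempty (FundamentalGroup _ x ≃* Γ)) ∧
        Nonempty (Γ ≃* PresentedGroup heisenbergRels) ∧
        Group.IsNilpotent Γ ∧
        ¬ IsVirtuallyAbelian Γ ∧
        -- `Γ` is unipotent
        ∀ γ ∈ Γ, IsNilpotent ((γ : SL(10, ℝ)) - 1 : Matrix (Fin 10) (Fin 10) ℝ) := by
  refine ⟨thetaDomain, thetaDomain.isStrictlyConvexDomain, integralTheta,
    isLatticeIn_integralTheta, thetaDomain.eq_one_of_smul_eq, inferInstance,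
    thetaDomain.isProjectiveManifoldVia, thetaDomain.nonempty_fundamentalGroup_mulEquiv,
    integralTheta.nonempty_mulEquiv_presentedGroup, integralTheta.isNilpotent,
    integralTheta.not_isVirtuallyAbelian, ?_⟩
  rintro _ ⟨i, j, k, rfl⟩
  rw [thetaMk.coe_matrix]
  exact thetaMk.isNilpotent_sub_one _ _ _
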